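/- Let $k$ be a field and let $\mathcal A$ be a $k$-linear abelian category that is Ext-finite, i.e. $\operatorname{Ext}^n_{\mathcal A}(X,Y)$ has finite length over $k$ for all objects $X,Y$ and all $n\ge 0$. Let $T$ be a tilting object of $\mathcal A$: the projective dimension of $T$ is at most $1$, $\operatorname{Ext}^1_{\mathcal A}(T,T)=0$, and every object $X$ with $\operatorname{Hom}_{\mathcal A}(T,X)=0=\operatorname{Ext}^1_{\mathcal A}(T,X)$ is zero. Let $\Lambda=\operatorname{End}_{\mathcal A}(T)$, let $\operatorname{mod}\Lambda$ be the abelian category of finitely generated right $\Lambda$-modules, and let $-\otimes_\Lambda T\colon\operatorname{mod}\Lambda\to\mathcal A$ be the left adjoint of $\operatorname{Hom}_{\mathcal A}(T,-)\colon\mathcal A\to\operatorname{mod}\Lambda$. Write $\mathbf K^{-,b}(\operatorname{proj}\Lambda)$ for the homotopy category of bounded above complexes of finitely generated projective right $\Lambda$-modules with bounded cohomology, and let $$-\otimes^{\mathbf L}_\Lambda T\colon\ \mathbf D^b(\operatorname{mod}\Lambda)\xrightarrow{\ \sim\ }\mathbf K^{-,b}(\operatorname{proj}\Lambda)\longrightarrow\mathbf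 D(\mathcal A)$$ be the derived functor, which sends a complex $P$ in $\mathbf K^{-,b}(\operatorname{proj}\Lambda)$ to $P\otimes_\Lambda T$. Then $-\otimes^{\mathbf L}_\Lambda T$ takes values in $\mathbf D^b(\mathcal A)$, and the resulting functor $$-\otimes^{\mathbf L}_\Lambda T\colon \mathbf D^b(\operatorname{mod}\Lambda)\longrightarrow\mathbf D^b(\mathcal A)$$ is an equivalence of triangulated categories. Moreover, the total right derived functor $\mathbf R\operatorname{Hom}_{\mathcal A}(T,-)\colon\mathbf D^b(\mathcal A)\to\mathbf D^b(\operatorname{mod}\Lambda)$ of $\operatorname{Hom}_{\mathcal A}(T,-)$ exists (as the universal, i.e. left Kan, extension along $\mathbf K^b(\mathcal A)\to\mathbf D^b(\mathcal A)$ of the functor $X\mapsto\operatorname{Hom}_{\mathcal A}(T,X)$ from $\mathbf K^b(\mathcal A)$ to $\mathbf D^b(\operatorname{mod}\Lambda)$), it is right adjoint to $-\otimes^{\mathbf L}_\Lambda T$, and it is a quasi-inverse of it: the unit and the counit of the adjunction are isomorphisms. -/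

import Mathlib

open CategoryTheory Category Limits Pretriangulated Triangulated Opposite

universe w w' w₁ w₂ v v' u u' t

noncomputable section

namespace Tilting

section Derived

variable (C : Type u) [Category.{v} C] [Abelian C]

/-- The objects of `K^{-,b}(Proj C)`, viewed inside the homotopy category of `C`: complexes of
projective objects that vanish in large degrees and have nonzero cohomology in only finitely many
degrees. -/
def projMinusBounded : ObjectProperty (HomotopyCategory C (ComplexShape.up ℤ)) :=
  fun K => (∀ n : ℤ, Projective (K.as.X n)) ∧ (∃ n : ℤ, ∀ i : ℤ, n < i → IsZero (K.as.X i)) ∧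
    {n : ℤ | ¬ IsZero ((HomotopyCategory.homologyFunctor C (ComplexShape.up ℤ) n).obj K)}.Finite

lemma projMinusBounded_shift (K : CochainComplex C ℤ) (a : ℤ)
    (hK : projMinusBounded C ((HomotopyCategory.quotient C _).obj K)) :
    projMinusBounded C ((HomotopyCategory.quotient C _).obj (K⟦a⟧)) := by
  obtain ⟨h1, ⟨n, h2⟩, h3⟩ := hK
  refine ⟨fun i => h1 (i + a), ⟨n - a, fun i hi => h2 (i + a) (by lia)⟩, ?_⟩
  refine (h3.preimage (f := fun i : ℤ => a + i) (by intro x _ y _ h; simpa using h)).subset ?_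
  intro i hi hz
  refine hi (hz.of_iso ?_)
  exact ((HomotopyCategory.homologyFunctorFactors C _ i).app _) ≪≫
    (((HomologicalComplex.homologyFunctor C (ComplexShape.up ℤ) 0).shiftIso a i (a + i) rfl).app K)
    ≪≫ ((HomotopyCategory.homologyFunctorFactors C _ (a + i)).app _).symm

instance : (projMinusBounded C).IsStableUnderShift ℤ where
  isStableUnderShiftBy a :=
    { le_shift K hK := by
        obtain ⟨K : CochainComplex _ _, rfl⟩ := K.quotient_obj_surjective
        rw [ObjectProperty.prop_shift_iff, HomotopyCategory.shift_quotient_obj]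
        exact projMinusBounded_shift C K a hK }

variable {C} in
lemma quasiIso_of_op {K L : CochainComplex C ℤ} (g : K ⟶ L)
    (h : QuasiIso ((CochainComplex.opEquivalence C).functor.map g.op)) : QuasiIso g := by
  rw [quasiIso_iff] at h ⊢
  intro n
  obtain ⟨m, rfl⟩ : ∃ m : ℤ, n = -m := ⟨-n, by simp⟩
  have hn := h m
  rw [quasiIsoAt_iff' _ (m - 1) m (m + 1) (by simp) (by simp)] at hn
  rw [quasiIsoAt_iff' _ (-(m + 1)) (-m) (-(m - 1)) (by simp; lia) (by simp; lia)]
  rw [← ShortComplex.quasiIso_opMap_iff]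
  exact hn

variable {C} in
lemma exists_quasiIso_projective [EnoughProjectives C] (K : CochainComplex C ℤ) (n : ℤ)
    [K.IsStrictlyLE n] : ∃ (P : CochainComplex C ℤ) (g : P ⟶ K), QuasiIso g ∧
      (∀ i, Projective (P.X i)) ∧ ∀ i : ℤ, n < i → IsZero (P.X i) := by
  let L := (CochainComplex.opEquivalence C).functor.obj (op K)
  have hL : L.IsStrictlyGE (-n) := by
    rw [CochainComplex.isStrictlyGE_iff]
    intro i hi
    exact (K.isZero_of_isStrictlyLE n (-i) (by lia)).op
  obtain ⟨M, i, hi, hM, hM'⟩ := CochainComplex.Plus.modelCategoryQuillen.exists_quasiIso_injective L (-n)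
  let g : op K ⟶ (CochainComplex.opEquivalence C).inverse.obj M :=
    (CochainComplex.opEquivalence C).toAdjunction.homEquiv _ _ i
  have hg : (CochainComplex.opEquivalence C).functor.map g ≫
      (CochainComplex.opEquivalence C).counitIso.hom.app M = i := by
    have := ((CochainComplex.opEquivalence C).toAdjunction.homEquiv _ _).symm_apply_apply i
    rw [Adjunction.homEquiv_counit] at this
    exact this
  refine ⟨((CochainComplex.opEquivalence C).inverse.obj M).unop, g.unop, ?_, ?_, ?_⟩
  · apply quasiIso_of_op
    have : QuasiIso ((CochainComplex.opEquivalence C).functor.map g.unop.op ≫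
      (CochainComplex.opEquivalence C).counitIso.hom.app M) := by
      rw [Quiver.Hom.op_unop, hg]
      exact hi
    exact quasiIso_of_comp_right _ ((CochainComplex.opEquivalence C).counitIso.hom.app M)
  · intro j
    have := hM (-j)
    exact inferInstanceAs (Projective (unop (M.X (-j))))
  · intro j hj
    exact (M.isZero_of_isStrictlyGE (-n) (-j) (by lia)).unop

variable [HasDerivedCategory.{w} C]

open DerivedCategory in
lemma bounded_iff (X : DerivedCategory C) :
    TStructure.t.bounded X ↔ {n : ℤ | ¬ IsZero ((homologyFunctor C n).obj X)}.Finite := by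
  constructor
  · rintro ⟨⟨a, (ha : X.IsGE a)⟩, ⟨b, (hb : X.IsLE b)⟩⟩
    refine (Set.finite_Icc a b).subset fun n hn => ?_
    by_contra h
    rw [Set.mem_Icc, not_and_or] at h
    rcases h with h | h
    · exact hn (X.isZero_of_isGE a n (by lia))
    · exact hn (X.isZero_of_isLE b n (by lia))
  · intro h
    obtain ⟨a, ha⟩ := h.bddBelow
    obtain ⟨b, hb⟩ := h.bddAbove
    refine ⟨⟨a, (X.isGE_iff a).2 fun i hi => ?_⟩, ⟨b, (X.isLE_iff b).2 fun i hi => ?_⟩⟩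
    · by_contra h'
      have := ha h'
      lia
    · by_contra h'
      have := hb h'
      lia

lemma bounded_Qh_iff (K : HomotopyCategory C (ComplexShape.up ℤ)) :
    DerivedCategory.TStructure.t.bounded (DerivedCategory.Qh.obj K) ↔
      {n : ℤ | ¬ IsZero
        ((HomotopyCategory.homologyFunctor C (ComplexShape.up ℤ) n).obj K)}.Finite := by
  rw [bounded_iff]
  have (n : ℤ) := ((DerivedCategory.homologyFunctorFactorsh C n).app K).isZero_iff
  simp only [Functor.comp_obj] at this
  simp only [this]

/-- The canonical functor `K^{-,b}(Proj C) ⥤ D^b(C)`. -/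
def projToDerived : (projMinusBounded C).FullSubcategory ⥤ DerivedCategory.Bounded C :=
  ObjectProperty.lift _ ((projMinusBounded C).ι ⋙ DerivedCategory.Qh)
    (fun K => (bounded_Qh_iff C K.obj).2 K.property.2.2)

instance : (projToDerived C).CommShift ℤ :=
  inferInstanceAs ((ObjectProperty.lift _ ((projMinusBounded C).ι ⋙ DerivedCategory.Qh)
    (fun K => (bounded_Qh_iff C K.obj).2 K.property.2.2)).CommShift ℤ)

lemma projToDerived_map_bijective (K L : (projMinusBounded C).FullSubcategory) :
    Function.Bijective ((projToDerived C).map : (K ⟶ L) → _) := by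
  obtain ⟨h1, ⟨n, h2⟩, h3⟩ := K.property
  have := (CochainComplex.isStrictlyLE_iff K.obj.as n).2 h2
  have : CochainComplex.IsKProjective K.obj.as := CochainComplex.isKProjective_of_projective _ n
  have h : Function.Bijective (DerivedCategory.Qh.map : (K.obj ⟶ L.obj) → _) :=
    CochainComplex.IsKProjective.Qh_map_bijective K.obj.as L.obj
  exact (Function.Bijective.of_comp_iff'
    (DerivedCategory.TStructure.t.bounded.fullyFaithfulι.map_bijective
      ((projToDerived C).obj K) ((projToDerived C).obj L)) _).1
    (h.comp ((projMinusBounded C).fullyFaithfulι.map_bijective K L))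

instance : (projToDerived C).Full where
  map_surjective := (projToDerived_map_bijective C _ _).surjective

instance : (projToDerived C).Faithful where
  map_injective h := (projToDerived_map_bijective C _ _).injective h

instance [EnoughProjectives C] : (projToDerived C).EssSurj where
  mem_essImage X := by
    obtain ⟨b, (hb : X.obj.IsLE b)⟩ := X.property.2
    obtain ⟨K, hK, ⟨e⟩⟩ := X.obj.exists_iso_Q_obj_of_isLE b
    obtain ⟨P, g, hg, hP, hP'⟩ := exists_quasiIso_projective K b
    let e' : DerivedCategory.Qh.obj ((HomotopyCategory.quotient C _).obj P) ≅ X.obj :=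
      (DerivedCategory.quotientCompQhIso C).app P ≪≫ asIso (DerivedCategory.Q.map g) ≪≫ e.symm
    refine ⟨⟨(HomotopyCategory.quotient C _).obj P, hP, ⟨b, hP'⟩, (bounded_Qh_iff C _).1 ?_⟩,
      ⟨ObjectProperty.isoMk _ e'⟩⟩
    exact ObjectProperty.prop_of_iso _ e'.symm X.property

/-- If `C` has enough projectives, then `K^{-,b}(Proj C) ⥤ D^b(C)` is an equivalence. -/
instance [EnoughProjectives C] : (projToDerived C).IsEquivalence where

/-- The inverse equivalence commutes with shifts, compatibly with the canonical functor. -/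
instance [EnoughProjectives C] : (projToDerived C).inv.CommShift ℤ :=
  letI : (projToDerived C).asEquivalence.functor.CommShift ℤ :=
    inferInstanceAs ((projToDerived C).CommShift ℤ)
  (projToDerived C).asEquivalence.toAdjunction.rightAdjointCommShift ℤ

variable {C} {D : Type u'} [Category.{v'} D] [Abelian D] [HasDerivedCategory.{w'} D]

/-- The left derived functor of `F` on the bounded derived category: the composition
`D^b(C) ≌ K^{-,b}(Proj C) ⥤ K(D) ⥤ D(D)` taking a complex `P` of projectives to `F P`. -/
def leftDerived [EnoughProjectives C] (F : C ⥤ D) [F.Additive] :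
    DerivedCategory.Bounded C ⥤ DerivedCategory D :=
  (projToDerived C).inv ⋙ (projMinusBounded C).ι ⋙
    F.mapHomotopyCategory (ComplexShape.up ℤ) ⋙ DerivedCategory.Qh

instance [EnoughProjectives C] (F : C ⥤ D) [F.Additive] : (leftDerived F).CommShift ℤ :=
  inferInstanceAs (((projToDerived C).inv ⋙ (projMinusBounded C).ι ⋙
    F.mapHomotopyCategory (ComplexShape.up ℤ) ⋙ DerivedCategory.Qh).CommShift ℤ)

variable (C) in
/-- The objects of `K^b(C)`: complexes with only finitely many nonzero terms. -/
def boundedComplexes : ObjectProperty (HomotopyCategory C (ComplexShape.up ℤ)) :=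
  fun K => {n : ℤ | ¬ IsZero (K.as.X n)}.Finite

lemma bounded_Qh_of_bounded (K : HomotopyCategory C (ComplexShape.up ℤ))
    (hK : boundedComplexes C K) :
    DerivedCategory.TStructure.t.bounded (DerivedCategory.Qh.obj K) := by
  rw [bounded_Qh_iff]
  refine hK.subset fun n hn h => hn ?_
  obtain ⟨K : CochainComplex _ _, rfl⟩ := K.quotient_obj_surjective
  refine IsZero.of_iso ?_ ((HomotopyCategory.homologyFunctorFactors C _ n).app K)
  exact ShortComplex.isZero_homology_of_isZero_X₂ _ h

variable (C) in
/-- The canonical functor `K^b(C) ⥤ D^b(C)`. -/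
def boundedToDerived : (boundedComplexes C).FullSubcategory ⥤ DerivedCategory.Bounded C :=
  ObjectProperty.lift _ ((boundedComplexes C).ι ⋙ DerivedCategory.Qh)
    (fun K => bounded_Qh_of_bounded K.obj K.property)

/-- The functor `K^b(C) ⥤ K^b(D) ⥤ D^b(D)` that applies `F` termwise. -/
def mapBounded (F : C ⥤ D) [F.Additive] :
    (boundedComplexes C).FullSubcategory ⥤ DerivedCategory.Bounded D :=
  ObjectProperty.lift _
    ((boundedComplexes C).ι ⋙ F.mapHomotopyCategory (ComplexShape.up ℤ) ⋙ DerivedCategory.Qh)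
    (fun K => bounded_Qh_of_bounded ((F.mapHomotopyCategory (ComplexShape.up ℤ)).obj K.obj)
      (K.property.subset fun _ hn h => hn (F.map_isZero h)))

/-- `R : D^b(C) ⥤ D^b(D)` is the (total) right derived functor of `F : C ⥤ D`: there is a natural
transformation from `K^b(C) ⥤ D^b(D)`, `X ↦ F X`, to the composition of `K^b(C) ⥤ D^b(C)` with `R`
that is universal among all such, i.e. exhibits `R` as a left Kan extension. -/
def IsRightDerived (F : C ⥤ D) [F.Additive]
    (R : DerivedCategory.Bounded C ⥤ DerivedCategory.Bounded D) : Prop :=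
  ∃ α : mapBounded F ⟶ boundedToDerived C ⋙ R, R.IsLeftKanExtension α

end Derived

section FG
variable (R : Type u) [Ring R] [IsNoetherianRing R]

lemma fg_epi_of_surjective {M N : FGModuleCat.{u} R} (f : M ⟶ N)
    (hf : Function.Surjective f.hom.hom) :
    Epi f := by
  have : Epi ((forget₂ (FGModuleCat.{u} R) (ModuleCat.{u} R)).map f) :=
    (ModuleCat.epi_iff_surjective _).2 hf
  exact (forget₂ (FGModuleCat.{u} R) (ModuleCat.{u} R)).epi_of_epi_map this

lemma fg_surjective_of_epi {M N : FGModuleCat.{u} R} (f : M ⟶ N) [Epi f] :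
    Function.Surjective f.hom.hom := by
  have : Epi ((forget₂ (FGModuleCat.{u} R) (ModuleCat.{u} R)).map f) := inferInstance
  exact (ModuleCat.epi_iff_surjective _).1 this

instance (n : ℕ) : Projective (FGModuleCat.of R (Fin n → R)) where
  factors {E X} f e he := by
    have := fg_surjective_of_epi R e
    obtain ⟨g, hg⟩ := Module.projective_lifting_property e.hom.hom f.hom.hom this
    exact ⟨FGModuleCat.ofHom g, by ext1; exact hg⟩

lemma exists_epi_fg (M : FGModuleCat.{u} R) :
    ∃ (n : ℕ) (f : FGModuleCat.of R (Fin n → R) ⟶ M), Epi f := by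
  obtain ⟨n, f, hf⟩ := Module.Finite.exists_fin' R M
  exact ⟨n, FGModuleCat.ofHom f, fg_epi_of_surjective R _ hf⟩

instance : EnoughProjectives (FGModuleCat.{u} R) where
  presentation M := by
    obtain ⟨n, f, hf⟩ := exists_epi_fg R M
    exact ⟨{ p := _, f := f }⟩
end FG

section

variable {k : Type t} [Field k] {A : Type u} [Category.{v} A] [Abelian A] [Linear k A]
  [HasExt.{w} A]

variable (k A) in
/-- `A` is Ext-finite: all `Ext^n(X, Y)` are of finite length over `k`. -/
def IsExtFinite : Prop :=
  ∀ (X Y : A) (n : ℕ), IsFiniteLength k (Abelian.Ext X Y n)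

/-- Tilting objects of an abelian category. -/
structure IsTilting (T : A) : Prop where
  hasProjectiveDimensionLE_one : HasProjectiveDimensionLE T 1
  ext_one_self : ∀ e : Abelian.Ext T T 1, e = 0
  isZero_of_hom_ext_eq_zero : ∀ X : A,
    (∀ f : T ⟶ X, f = 0) → (∀ e : Abelian.Ext T X 1, e = 0) → IsZero X

lemma IsExtFinite.finite_hom (hA : IsExtFinite k A) (X Y : A) : Module.Finite k (X ⟶ Y) := by
  have h := hA X Y 0
  rw [isFiniteLength_iff_isNoetherian_isArtinian] at h
  have := h.1
  exact Module.Finite.equiv (Abelian.Ext.linearEquiv₀ (R := k) (X := X) (Y := Y))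

lemma IsExtFinite.finite_hom_end (hA : IsExtFinite k A) (T X : A) :
    Module.Finite (End T)ᵐᵒᵖ (T ⟶ X) := by
  have := hA.finite_hom T X
  have : IsScalarTower k (End T)ᵐᵒᵖ (T ⟶ X) := ⟨fun a f g => by
    change (a • f.unop) ≫ g = a • (f.unop ≫ g)
    exact Linear.smul_comp _ _ _ _ _ _⟩
  exact Module.Finite.of_restrictScalars_finite k _ _

lemma IsExtFinite.isNoetherianRing_end (hA : IsExtFinite k A) (T : A) :
    IsNoetherianRing (End T)ᵐᵒᵖ := by
  have : Module.Finite k (End T) := hA.finite_hom T T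
  have : Module.Finite k (End T)ᵐᵒᵖ := Module.Finite.equiv (MulOpposite.opLinearEquiv k)
  exact isNoetherian_of_tower k inferInstance

/-- The functor `Hom(T, -) : A ⥤ mod Λ`, where `Λ = End T` (with multiplication `f * g = f ∘ g`) and
`mod Λ` is the category of finitely generated right `Λ`-modules, i.e. of finitely generated left
`Λᵐᵒᵖ`-modules. -/
def homFunctor (hA : IsExtFinite k A) (T : A) : A ⥤ FGModuleCat.{v} (End T)ᵐᵒᵖ :=
  ObjectProperty.lift _ (preadditiveCoyonedaObj T) (hA.finite_hom_end T)

instance (hA : IsExtFinite k A) (T : A) : (homFunctor hA T).Additive where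
  map_add {X Y f g} := by
    ext x
    exact Preadditive.comp_add _ _ _ _ _ _

lemma leftAdjointObjIsDefined_free (hA : IsExtFinite k A) (T : A) (n : ℕ) :
    (homFunctor hA T).leftAdjointObjIsDefined (FGModuleCat.of _ (Fin n → (End T)ᵐᵒᵖ)) := by
  have := Abelian.hasFiniteBiproducts (C := A)
  have := hA.finite_hom_end T
  have key {Y : A} (f : (⨁ fun _ : Fin n => T) ⟶ Y) (i : Fin n) :
      (Pi.basisFun (End T)ᵐᵒᵖ (Fin n)).constr ℕ (fun i => biproduct.ι (fun _ : Fin n => T) i ≫ f)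
        (Pi.basisFun (End T)ᵐᵒᵖ (Fin n) i) = biproduct.ι (fun _ : Fin n => T) i ≫ f :=
    Module.Basis.constr_basis _ _ _ _
  rw [Functor.leftAdjointObjIsDefined_iff]
  refine Functor.CorepresentableBy.isCorepresentable (X := ⨁ fun _ : Fin n => T)
    { homEquiv := fun {Y} =>
        { toFun := fun f => FGModuleCat.ofHom ((Pi.basisFun (End T)ᵐᵒᵖ (Fin n)).constr ℕ
            (fun i => biproduct.ι (fun _ : Fin n => T) i ≫ f))
          invFun := fun φ => biproduct.desc fun i =>
            (φ.hom.hom (Pi.basisFun (End T)ᵐᵒᵖ (Fin n) i) : T ⟶ Y)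
          left_inv := ?_
          right_inv := ?_ }
      homEquiv_comp := ?_ }
  · intro f
    refine biproduct.hom_ext' _ _ fun i => ?_
    refine (biproduct.ι_desc _ _).trans ?_
    exact key f i
  · intro φ
    apply FGModuleCat.hom_ext
    refine (Pi.basisFun (End T)ᵐᵒᵖ (Fin n)).ext fun i => ?_
    refine (key _ i).trans ?_
    exact biproduct.ι_desc _ _
  · intro Y Y' g f
    apply FGModuleCat.hom_ext
    refine (Pi.basisFun (End T)ᵐᵒᵖ (Fin n)).ext fun i => ?_
    refine (key (f ≫ g) i).trans ((assoc _ _ _).symm.trans ?_)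
    exact congrArg (fun h : T ⟶ Y => h ≫ g) (key f i).symm

instance (hA : IsExtFinite k A) (T : A) [IsNoetherianRing (End T)ᵐᵒᵖ] :
    (homFunctor hA T).IsRightAdjoint := by
  apply Functor.isRightAdjoint_of_leftAdjointObjIsDefined_eq_top
  ext M
  simp only [Pi.top_apply, Prop.top_eq_true, iff_true]
  obtain ⟨n, f, hf⟩ := exists_epi_fg _ M
  obtain ⟨m, g, hg⟩ := exists_epi_fg _ (kernel f)
  refine Functor.leftAdjointObjIsDefined_of_isColimit
    (isCokernelEpiComp (Abelian.epiIsCokernelOfKernel _ (kernelIsKernel f)) g rfl) ?_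
  rintro (_ | _)
  · exact leftAdjointObjIsDefined_free hA T m
  · exact leftAdjointObjIsDefined_free hA T n

variable (hA : IsExtFinite k A) (T : A) [IsNoetherianRing (End T)ᵐᵒᵖ]

/-- The functor `- ⊗_Λ T : mod Λ ⥤ A`, the left adjoint of `Hom(T, -)`. -/
def tensorFunctor : FGModuleCat.{v} (End T)ᵐᵒᵖ ⥤ A := (homFunctor hA T).leftAdjoint

/-- The adjunction between `- ⊗_Λ T` and `Hom(T, -)`. -/
def tensorHomAdjunction : tensorFunctor hA T ⊣ homFunctor hA T := Adjunction.ofIsRightAdjoint _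

instance : (tensorFunctor hA T).Additive := (tensorHomAdjunction hA T).left_adjoint_additive

variable [HasDerivedCategory.{w₁} A] [HasDerivedCategory.{w₂} (FGModuleCat.{v} (End T)ᵐᵒᵖ)]

/-- The derived functor `- ⊗ᴸ_Λ T`, as a functor `D^b(mod Λ) ⥤ D(A)`: it takes a complex `P` of
projective `Λ`-modules with bounded cohomology to `P ⊗_Λ T`. -/
abbrev derivedTensor :
    DerivedCategory.Bounded (FGModuleCat.{v} (End T)ᵐᵒᵖ) ⥤ DerivedCategory A :=
  leftDerived (tensorFunctor hA T)

/-- The derived functor `- ⊗ᴸ_Λ T : D^b(mod Λ) ⥤ D^b(A)`, once its values are known to have bounded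
cohomology. -/
abbrev derivedTensorBounded
    (hb : ∀ X, DerivedCategory.TStructure.t.bounded ((derivedTensor hA T).obj X)) :
    DerivedCategory.Bounded (FGModuleCat.{v} (End T)ᵐᵒᵖ) ⥤ DerivedCategory.Bounded A :=
  ObjectProperty.lift _ (derivedTensor hA T) hb

end

end Tilting

end

/-! Call an object X acyclic if Ext¹(T, X) = 0. Since T has projective dimension at most 1,
quotients of acyclic objects are acyclic. Since Ext¹(T, T) = 0 and Ext groups are finite
dimensional, repeated extension by T embeds every object in an acyclic one
(`exists_mono_isExtAcyclic`). Hence every complex is quasi-isomorphic to one with acyclic terms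
(`exists_isIso_Qh_map_extAcyclic`). The condition that Hom and Ext¹ from T detect zero objects
enters once, in `IsTilting.exact_of_isHomExact`: on complexes with acyclic terms, exactness can be
tested after Hom(T, -). So Hom(T, -) preserves and detects quasi-isomorphisms between them.

For projective P the unit P ⟶ Hom(T, P ⊗ T) is invertible and P ⊗ T is acyclic. For a right bounded
complex P of projectives and Y with acyclic terms, morphisms P ⊗ T ⟶ Y are therefore the same in the
homotopy and the derived category (`IsTilting.Qh_map_bijective`); Y = Q ⊗ T gives full faithfulness.
For essential surjectivity, replace a bounded X by Y with acyclic terms and resolve Hom(T, Y) by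
projectives P: the adjunct P ⊗ T ⟶ Y is a quasi-isomorphism because P ⟶ Hom(T, Y) is.

A right adjoint R of this equivalence agrees with Hom(T, -) on bounded complexes with acyclic terms.
As these resolve all bounded complexes and morphisms in the bounded derived category are left
fractions, R is the required left Kan extension (`isLeftKanExtension_of_resolutions`). -/

noncomputable section

namespace Tilting

/-! ### Objects X with Ext¹(T, X) = 0. -/

section ExtAcyclic

variable {A : Type u} [Category.{v} A] [Abelian A] [HasExt.{w} A]

/-- `X` is `T`-acyclic if `Ext¹(T, X) = 0`. -/
def IsExtAcyclic (T X : A) : Prop := ∀ e : Abelian.Ext T X 1, e = 0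

variable {T : A}

/-- The obstruction lies in Ext² of T with the kernel, which vanishes by the bound on the projective
dimension. -/
lemma IsExtAcyclic.of_epi [HasProjectiveDimensionLE T 1] {X Y : A} (hX : IsExtAcyclic T X)
    (f : X ⟶ Y) [Epi f] : IsExtAcyclic T Y := by
  intro e
  have hS : (ShortComplex.mk _ _ (kernel.condition f)).ShortExact :=
    { exact := ShortComplex.exact_kernel f }
  obtain ⟨x, hx⟩ := Abelian.Ext.covariant_sequence_exact₃ T hS e (n₁ := 2) rfl
    (Abelian.Ext.eq_zero_of_hasProjectiveDimensionLT _ 2 le_rfl)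
  rw [← hx, hX x]
  simp

lemma IsExtAcyclic.of_iso {X Y : A} (hX : IsExtAcyclic T X) (e : X ≅ Y) : IsExtAcyclic T Y := by
  intro x
  have h := hX (x.comp (Abelian.Ext.mk₀ e.inv) (add_zero 1))
  have h' := congrArg (fun y => y.comp (Abelian.Ext.mk₀ e.hom) (add_zero 1)) h
  simpa using h'

lemma IsExtAcyclic.of_isZero {X : A} (hX : IsZero X) : IsExtAcyclic T X := by
  intro x
  rw [← Abelian.Ext.comp_mk₀_id x, hX.eq_of_src (𝟙 X) 0]
  simp

/-- Splitting only the identity of `Z`, with no biproduct structure, matches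
`CochainComplex.mappingCone.id_X`. -/
lemma IsExtAcyclic.of_decomposition {X Y Z : A} (hX : IsExtAcyclic T X) (hY : IsExtAcyclic T Y)
    (p : Z ⟶ X) (i : X ⟶ Z) (q : Z ⟶ Y) (j : Y ⟶ Z) (h : p ≫ i + q ≫ j = 𝟙 Z) :
    IsExtAcyclic T Z := by
  intro x
  rw [← Abelian.Ext.comp_mk₀_id x, ← h, Abelian.Ext.mk₀_add, Abelian.Ext.comp_add,
    ← Abelian.Ext.mk₀_comp_mk₀, ← Abelian.Ext.mk₀_comp_mk₀,
    ← Abelian.Ext.comp_assoc_of_third_deg_zero, ← Abelian.Ext.comp_assoc_of_third_deg_zero,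
    hX (x.comp _ _), hY (x.comp _ _)]
  simp

lemma IsExtAcyclic.exists_lift {S : ShortComplex A} (hS : S.ShortExact)
    (h₁ : IsExtAcyclic T S.X₁) (f : T ⟶ S.X₃) : ∃ g : T ⟶ S.X₂, g ≫ S.g = f := by
  obtain ⟨x, hx⟩ := Abelian.Ext.covariant_sequence_exact₃ T hS (Abelian.Ext.mk₀ f) rfl (h₁ _)
  obtain ⟨g, rfl⟩ := (Abelian.Ext.mk₀_bijective T S.X₂).surjective x
  exact ⟨g, (Abelian.Ext.mk₀_bijective T S.X₃).injective (by simpa using hx)⟩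

/-- The connecting map Hom(T, X₃) ⟶ Ext¹(T, X₁) is onto because Ext¹(T, X₂) = 0, and zero because
every map lifts. -/
lemma IsExtAcyclic.of_exists_lift {S : ShortComplex A} (hS : S.ShortExact)
    (h₂ : IsExtAcyclic T S.X₂) (h : ∀ f : T ⟶ S.X₃, ∃ g : T ⟶ S.X₂, g ≫ S.g = f) :
    IsExtAcyclic T S.X₁ := by
  intro e
  obtain ⟨x, hx⟩ := Abelian.Ext.covariant_sequence_exact₁ T hS e (h₂ _) (zero_add 1)
  obtain ⟨f, rfl⟩ := (Abelian.Ext.mk₀_bijective T S.X₃).surjective x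
  obtain ⟨g, rfl⟩ := h f
  rw [← hx, ← Abelian.Ext.mk₀_comp_mk₀, Abelian.Ext.comp_assoc_of_second_deg_zero]
  simp

open DerivedCategory in
/-- Each class `e ∈ Ext¹(Z, X)` is killed by a monomorphism `X ⟶ Y` with cokernel `Z`; only the
resulting surjectivity on `Ext¹(W, -)` for `Ext¹(W, Z) = 0` is recorded. -/
lemma exists_mono_comp_eq_zero {X Z : A} (e : Abelian.Ext Z X 1) :
    ∃ (Y : A) (i : X ⟶ Y), Mono i ∧ e.comp (Abelian.Ext.mk₀ i) (add_zero 1) = 0 ∧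
      ∀ W : A, IsExtAcyclic W Z → ∀ y : Abelian.Ext W Y 1,
        ∃ x : Abelian.Ext W X 1, x.comp (Abelian.Ext.mk₀ i) (add_zero 1) = y := by
  let := HasDerivedCategory.standard A
  let δ : (singleFunctor A 0).obj Z ⟶ ((singleFunctor A 0).obj X)⟦(1 : ℤ)⟧ := e.hom
  -- Completing the class, read as a map Z ⟶ X[1], to a triangle gives an object concentrated in
  -- degree 0: the middle term of the extension.
  obtain ⟨E, a, b, hT⟩ := distinguished_cocone_triangle₂ δ
  have hGE : E.IsGE 0 := TStructure.t.isGE₂ _ hT 0 (inferInstanceAs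
    (DerivedCategory.IsGE ((singleFunctor A 0).obj X) 0)) (inferInstanceAs
    (DerivedCategory.IsGE ((singleFunctor A 0).obj Z) 0))
  have hLE : E.IsLE 0 := TStructure.t.isLE₂ _ hT 0 (inferInstanceAs
    (DerivedCategory.IsLE ((singleFunctor A 0).obj X) 0)) (inferInstanceAs
    (DerivedCategory.IsLE ((singleFunctor A 0).obj Z) 0))
  obtain ⟨Y, ⟨φ⟩⟩ := exists_iso_singleFunctor_obj_of_isGE_of_isLE E 0
  obtain ⟨i, hi⟩ := (singleFunctor A 0).map_surjective (a ≫ φ.hom)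
  obtain ⟨p, hp⟩ := (singleFunctor A 0).map_surjective (φ.inv ≫ b)
  have hT' : Triangle.mk ((singleFunctor A 0).map i) ((singleFunctor A 0).map p) δ ∈
      distTriang (DerivedCategory A) := by
    refine isomorphic_distinguished _ hT _
      (Triangle.isoMk _ _ (Iso.refl _) φ.symm (Iso.refl _) ?_ ?_ ?_)
    · change (singleFunctor A 0).map i ≫ φ.inv = 𝟙 _ ≫ a
      simp [hi]
    · change (singleFunctor A 0).map p ≫ 𝟙 _ = φ.inv ≫ b
      rw [hp, comp_id]
    · change δ ≫ (𝟙 _)⟦(1 : ℤ)⟧' = 𝟙 _ ≫ δ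
      rw [CategoryTheory.Functor.map_id, comp_id, id_comp]
  refine ⟨Y, i, ?_, ?_, ?_⟩
  · rw [Preadditive.mono_iff_cancel_zero]
    intro W g hg
    -- A map killed by `i` comes from Z[-1], and there are no nonzero maps from degree 0 to Z[-1].
    obtain ⟨h, hh⟩ := Triangle.coyoneda_exact₂ _ (inv_rot_of_distTriang _ hT')
      ((singleFunctor A 0).map g) (by
        refine ((singleFunctor A 0).map_comp g i).symm.trans ?_
        rw [hg, Functor.map_zero]
        rfl)
    have hW : TStructure.t.IsLE ((singleFunctor A 0).obj W) 0 :=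
      inferInstanceAs (DerivedCategory.IsLE ((singleFunctor A 0).obj W) 0)
    have hZ : TStructure.t.IsGE ((singleFunctor A 0).obj Z) 0 :=
      inferInstanceAs (DerivedCategory.IsGE ((singleFunctor A 0).obj Z) 0)
    have hZ' := TStructure.t.isGE_shift ((singleFunctor A 0).obj Z) 0 (-1) 1 (by lia)
    have h0 : h = 0 := TStructure.t.zero (Y := ((singleFunctor A 0).obj Z)⟦(-1 : ℤ)⟧) h 0 1 (by lia)
    refine (singleFunctor A 0).map_injective ?_
    rw [hh, h0, Functor.map_zero]
    exact zero_comp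
  · ext
    rw [Abelian.Ext.comp_hom, Abelian.Ext.mk₀_hom, Abelian.Ext.zero_hom]
    refine (ShiftedHom.comp_mk₀ _ _ _ _).trans ?_
    exact comp_distTriang_mor_zero₃₁ _ hT'
  · intro W hW y
    have hy := congrArg Abelian.Ext.hom (hW (y.comp (Abelian.Ext.mk₀ p) (add_zero 1)))
    rw [Abelian.Ext.comp_hom, Abelian.Ext.mk₀_hom, Abelian.Ext.zero_hom] at hy
    have hy' : y.hom ≫ ((singleFunctor A 0).map p)⟦(1 : ℤ)⟧' = 0 :=
      (ShiftedHom.comp_mk₀ _ _ _ _).symm.trans hy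
    obtain ⟨x, hx⟩ := Triangle.coyoneda_exact₃ _
      (rot_of_distTriang _ (rot_of_distTriang _ hT')) y.hom (by
        refine (Preadditive.comp_neg _ _).trans ?_
        rw [neg_eq_zero]
        exact hy')
    -- Rotating twice turns `i` into -i[1], hence the sign.
    obtain ⟨x', hx'⟩ := Abelian.Ext.homEquiv.surjective (-x)
    refine ⟨x', ?_⟩
    ext
    rw [Abelian.Ext.comp_hom, Abelian.Ext.mk₀_hom]
    refine (ShiftedHom.comp_mk₀ _ _ _ _).trans ?_
    rw [hx]
    change Abelian.Ext.homEquiv x' ≫ _ = _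
    rw [hx']
    refine (Preadditive.neg_comp _ _).trans (Preadditive.comp_neg _ _).symm

variable {k : Type t} [Field k] [Linear k A]

/-- If `Ext¹(T, T) = 0` and all `Ext¹(T, X)` are finite dimensional, every object embeds in a
`T`-acyclic one. -/
lemma exists_mono_isExtAcyclic (hA : IsExtFinite k A) (hT : IsExtAcyclic T T) (X : A) :
    ∃ (Y : A) (i : X ⟶ Y), Mono i ∧ IsExtAcyclic T Y := by
  have hfin (Z : A) : Module.Finite k (Abelian.Ext T Z 1) := by
    have h := hA T Z 1
    rw [isFiniteLength_iff_isNoetherian_isArtinian] at h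
    have := h.1
    infer_instance
  obtain ⟨n, hn⟩ : ∃ n, Module.finrank k (Abelian.Ext T X 1) = n := ⟨_, rfl⟩
  induction n using Nat.strong_induction_on generalizing X with
  | _ n ih =>
    by_cases hX : IsExtAcyclic T X
    · exact ⟨X, 𝟙 X, inferInstance, hX⟩
    · obtain ⟨e, he⟩ : ∃ e : Abelian.Ext T X 1, e ≠ 0 := by simpa [IsExtAcyclic] using hX
      obtain ⟨Z, i, hi, hei, h⟩ := exists_mono_comp_eq_zero e
      have := hfin X
      let φ := (Abelian.Ext.mk₀ i).postcompOfLinear k T (add_zero 1)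
      have hφ : Function.Surjective φ := h T hT
      -- The extension of `T` by `X` with class `e` makes Ext¹(T, -) drop in dimension: the induced
      -- map is onto as Ext¹(T, T) = 0, and it kills `e`.
      have hlt : Module.finrank k (Abelian.Ext T Z 1) < n := by
        have h1 := φ.finrank_range_add_finrank_ker
        rw [LinearMap.range_eq_top.2 hφ, finrank_top, hn] at h1
        have h2 : 0 < Module.finrank k φ.ker := by
          rw [Module.finrank_pos_iff]
          exact ⟨⟨e, hei⟩, 0, fun h => he (congrArg Subtype.val h)⟩
        lia
      obtain ⟨Y, j, hj, hY⟩ := ih _ hlt Z rfl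
      exact ⟨Y, i ≫ j, mono_comp i j, hY⟩

end ExtAcyclic

/-! ### Exactness before and after applying Hom(T, -). -/

section Exactness

variable {A : Type u} [Category.{v} A] [Abelian A]

/-- The short complex `S` becomes exact after applying `Hom(T, -)`. -/
def IsHomExact (T : A) (S : ShortComplex A) : Prop :=
  ∀ f : T ⟶ S.X₂, f ≫ S.g = 0 → ∃ g : T ⟶ S.X₁, g ≫ S.f = f

lemma shortExact_kernel_of_fac {X Y Z : A} (f : X ⟶ Y) (p : X ⟶ Z) (m : Z ⟶ Y) [Epi p] [Mono m]
    (fac : p ≫ m = f) :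
    (ShortComplex.mk (kernel.ι f) p (by rw [← cancel_mono m]; simp [fac])).ShortExact where
  exact := by
    rw [ShortComplex.exact_iff_exact_up_to_refinements]
    intro W x hx
    have hx' : x ≫ f = 0 :=
      (congrArg (x ≫ ·) fac.symm).trans ((assoc x p m).symm.trans
        ((congrArg (· ≫ m) hx).trans zero_comp))
    exact ⟨W, 𝟙 W, inferInstance, kernel.lift f x hx', by simp⟩

variable [HasExt.{w} A] {T : A}

/-- Hom-exactness at `Y` lifts every map from T to the image of `b`, so ker b is acyclic, and so is
its quotient C = ker b / im a. The image of `a` is acyclic as a quotient of `W`, so a map T ⟶ C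
lifts to ker b; by Hom-exactness at `X` the lift factors through `W`, so the map is zero. Thus C =
0. -/
lemma IsTilting.exact_of_isHomExact (hT : IsTilting T) {W X Y Z : A} {a : W ⟶ X} {b : X ⟶ Y}
    {c : Y ⟶ Z} (hab : a ≫ b = 0) (hbc : b ≫ c = 0) (hW : IsExtAcyclic T W)
    (hX : IsExtAcyclic T X) (h₁ : IsHomExact T (ShortComplex.mk a b hab))
    (h₂ : IsHomExact T (ShortComplex.mk b c hbc)) : (ShortComplex.mk a b hab).Exact := by
  have := hT.hasProjectiveDimensionLE_one
  have hK : IsExtAcyclic T (kernel b) := by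
    refine IsExtAcyclic.of_exists_lift (shortExact_kernel_of_fac b (Abelian.factorThruImage b)
      (Abelian.image.ι b) (Abelian.image.fac b)) hX fun f => ?_
    obtain ⟨g, hg⟩ := h₂ (f ≫ Abelian.image.ι b) (by
      have : Abelian.image.ι b ≫ c = 0 := by
        rw [← cancel_epi (Abelian.factorThruImage b)]
        simpa using hbc
      simp [this])
    refine ⟨g, ?_⟩
    rw [← cancel_mono (Abelian.image.ι b)]
    simpa using hg
  let a' : W ⟶ kernel b := kernel.lift b a hab
  have hS : (ShortComplex.mk (Abelian.image.ι a') (cokernel.π a') (by simp)).ShortExact :=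
    { exact := ShortComplex.exact_kernel (cokernel.π a') }
  have hI : IsExtAcyclic T (Abelian.image a') := hW.of_epi (Abelian.factorThruImage a')
  have hC : IsZero (cokernel a') := by
    refine hT.isZero_of_hom_ext_eq_zero _ (fun f => ?_) (hK.of_epi (cokernel.π a'))
    obtain ⟨g, rfl⟩ := IsExtAcyclic.exists_lift hS hI f
    obtain ⟨g', hg'⟩ := h₁ (g ≫ kernel.ι b) (by simp)
    have : g = g' ≫ a' := by
      rw [← cancel_mono (kernel.ι b)]
      simpa [a'] using hg'.symm
    simp [this]
  have : Epi a' := Preadditive.epi_of_isZero_cokernel a' hC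
  exact (ShortComplex.exact_iff_epi_kernel_lift _).2 this

/-- Exactness implies `Hom(T, -)`-exactness, for complexes of `T`-acyclic objects. -/
lemma isHomExact_of_exact [HasProjectiveDimensionLE T 1] {V W X Y : A} {z : V ⟶ W} {a : W ⟶ X}
    {b : X ⟶ Y} (hza : z ≫ a = 0) (hab : a ≫ b = 0) (hV : IsExtAcyclic T V)
    (h₁ : (ShortComplex.mk z a hza).Exact) (h₂ : (ShortComplex.mk a b hab).Exact) :
    IsHomExact T (ShortComplex.mk a b hab) := by
  intro f hf
  have hepi : Epi (kernel.lift a z hza) := (ShortComplex.exact_iff_epi_kernel_lift _).1 h₁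
  have hepi' : Epi (kernel.lift b a hab) := (ShortComplex.exact_iff_epi_kernel_lift _).1 h₂
  have hS := shortExact_kernel_of_fac a (kernel.lift b a hab) (kernel.ι b) (by simp)
  -- By exactness ker a is a quotient of `V`, hence acyclic, and ker b is the quotient of `W` by it.
  obtain ⟨g, hg⟩ := IsExtAcyclic.exists_lift hS (hV.of_epi (kernel.lift a z hza))
    (kernel.lift b f hf)
  refine ⟨g, ?_⟩
  have := congrArg (fun y => y ≫ kernel.ι b) hg
  simpa using this

lemma isExtAcyclic_mappingCone {K L : CochainComplex A ℤ} (f : K ⟶ L)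
    (hK : ∀ n, IsExtAcyclic T (K.X n)) (hL : ∀ n, IsExtAcyclic T (L.X n)) (n : ℤ) :
    IsExtAcyclic T ((CochainComplex.mappingCone f).X n) :=
  IsExtAcyclic.of_decomposition (hK (n + 1)) (hL n) _ _ _ _
    (CochainComplex.mappingCone.id_X f n (n + 1) rfl)

end Exactness

/-! ### Hom(T, -) on complexes with acyclic terms. -/

section HomFunctor

variable {k : Type t} [Field k] {A : Type u} [Category.{v} A] [Abelian A] [Linear k A]
  [HasExt.{w} A] (hA : IsExtFinite k A) {T : A} [IsNoetherianRing (End T)ᵐᵒᵖ]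

lemma exact_map_homFunctor_iff (S : ShortComplex A) :
    (S.map (homFunctor hA T)).Exact ↔ IsHomExact T S := by
  rw [← ShortComplex.exact_map_iff_of_faithful _
    (forget₂ (FGModuleCat.{v} (End T)ᵐᵒᵖ) (ModuleCat.{v} (End T)ᵐᵒᵖ)),
    ShortComplex.moduleCat_exact_iff]
  rfl

lemma homFunctor_exactAt_iff (K : CochainComplex A ℤ) (n₀ n₁ n₂ : ℤ) (h₀₁ : n₀ + 1 = n₁)
    (h₁₂ : n₁ + 1 = n₂) :
    (((homFunctor hA T).mapHomologicalComplex (ComplexShape.up ℤ)).obj K).ExactAt n₁ ↔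
      IsHomExact T (K.sc' n₀ n₁ n₂) := by
  rw [HomologicalComplex.exactAt_iff' _ n₀ n₁ n₂ (by simp; lia) (by simp; lia),
    ← exact_map_homFunctor_iff hA]
  rfl

/-- Working degree by degree, at the cost of one neighbouring degree, also controls bounded
cohomology. `homFunctor_exactAt` is the converse, with the neighbour on the other side. -/
lemma IsTilting.exactAt_of_homFunctor (hT : IsTilting T) (K : CochainComplex A ℤ)
    (hK : ∀ n, IsExtAcyclic T (K.X n)) (n₀ n₁ : ℤ) (h : n₀ + 1 = n₁)
    (h₀ : (((homFunctor hA T).mapHomologicalComplex (ComplexShape.up ℤ)).obj K).ExactAt n₀)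
    (h₁ : (((homFunctor hA T).mapHomologicalComplex (ComplexShape.up ℤ)).obj K).ExactAt n₁) :
    K.ExactAt n₀ := by
  rw [homFunctor_exactAt_iff hA K (n₀ - 1) n₀ n₁ (by lia) h] at h₀
  rw [homFunctor_exactAt_iff hA K n₀ n₁ (n₁ + 1) h rfl] at h₁
  rw [HomologicalComplex.exactAt_iff' _ (n₀ - 1) n₀ n₁ (by simp) (by simp; lia)]
  exact hT.exact_of_isHomExact _ _ (hK _) (hK _) h₀ h₁

lemma homFunctor_exactAt [HasProjectiveDimensionLE T 1] (K : CochainComplex A ℤ)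
    (hK : ∀ n, IsExtAcyclic T (K.X n)) (n₀ n₁ : ℤ) (h : n₀ + 1 = n₁)
    (h₀ : K.ExactAt n₀) (h₁ : K.ExactAt n₁) :
    (((homFunctor hA T).mapHomologicalComplex (ComplexShape.up ℤ)).obj K).ExactAt n₁ := by
  rw [HomologicalComplex.exactAt_iff' _ (n₀ - 1) n₀ n₁ (by simp) (by simp; lia)] at h₀
  rw [HomologicalComplex.exactAt_iff' _ n₀ n₁ (n₁ + 1) (by simp; lia) (by simp)] at h₁
  rw [homFunctor_exactAt_iff hA K n₀ n₁ (n₁ + 1) h rfl]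
  exact isHomExact_of_exact _ _ (hK _) h₀ h₁

variable (T) in
/-- Complexes with `T`-acyclic terms, as objects of the homotopy category. -/
def extAcyclicComplexes : ObjectProperty (HomotopyCategory A (ComplexShape.up ℤ)) :=
  fun K => ∀ n, IsExtAcyclic T (K.as.X n)

lemma IsTilting.homFunctor_acyclic_iff (hT : IsTilting T)
    (K : HomotopyCategory A (ComplexShape.up ℤ)) (hK : extAcyclicComplexes T K) :
    HomotopyCategory.subcategoryAcyclic _
      (((homFunctor hA T).mapHomotopyCategory (ComplexShape.up ℤ)).obj K) ↔
    HomotopyCategory.subcategoryAcyclic _ K := by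
  have := hT.hasProjectiveDimensionLE_one
  obtain ⟨K : CochainComplex A ℤ, rfl⟩ := K.quotient_obj_surjective
  refine (HomotopyCategory.quotient_obj_mem_subcategoryAcyclic_iff_exactAt
    (((homFunctor hA T).mapHomologicalComplex (ComplexShape.up ℤ)).obj K)).trans ?_
  rw [HomotopyCategory.quotient_obj_mem_subcategoryAcyclic_iff_exactAt]
  exact ⟨fun h n => hT.exactAt_of_homFunctor hA K hK n (n + 1) rfl (h _) (h _),
    fun h n => homFunctor_exactAt hA K hK (n - 1) n (by lia) (h _) (h _)⟩

variable [HasDerivedCategory.{w₁} A] [HasDerivedCategory.{w₂} (FGModuleCat.{v} (End T)ᵐᵒᵖ)]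

lemma isIso_Qh_map_iff_of_distTriang {C : Type u} [Category.{v} C] [Abelian C]
    [HasDerivedCategory.{w} C] (D : Triangle (HomotopyCategory C (ComplexShape.up ℤ)))
    (hD : D ∈ distTriang _) : IsIso (DerivedCategory.Qh.map D.mor₁) ↔
      HomotopyCategory.subcategoryAcyclic C D.obj₃ := by
  rw [DerivedCategory.isIso_Qh_map_iff, HomotopyCategory.quasiIso_eq_trW_subcategoryAcyclic]
  exact ObjectProperty.trW_iff_of_distinguished _ D hD

/-- A morphism between complexes with `T`-acyclic terms is a quasi-isomorphism if and only if
it becomes one after applying `Hom(T, -)`. -/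
lemma IsTilting.isIso_Qh_map_homFunctor_iff (hT : IsTilting T)
    {K L : HomotopyCategory A (ComplexShape.up ℤ)} (f : K ⟶ L)
    (hK : extAcyclicComplexes T K) (hL : extAcyclicComplexes T L) :
    IsIso (DerivedCategory.Qh.map
      (((homFunctor hA T).mapHomotopyCategory (ComplexShape.up ℤ)).map f)) ↔
    IsIso (DerivedCategory.Qh.map f) := by
  obtain ⟨K : CochainComplex A ℤ, rfl⟩ := K.quotient_obj_surjective
  obtain ⟨L : CochainComplex A ℤ, rfl⟩ := L.quotient_obj_surjective
  obtain ⟨f, rfl⟩ := (HomotopyCategory.quotient A _).map_surjective f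
  have hD : CochainComplex.mappingCone.triangleh f ∈ distTriang _ := ⟨_, _, f, ⟨Iso.refl _⟩⟩
  refine Iff.trans ?_ (isIso_Qh_map_iff_of_distTriang _ hD).symm
  refine (isIso_Qh_map_iff_of_distTriang _ (((homFunctor hA T).mapHomotopyCategory
    (ComplexShape.up ℤ)).map_distinguished _ hD)).trans ?_
  exact hT.homFunctor_acyclic_iff hA _ (isExtAcyclic_mappingCone f hK hL)

end HomFunctor

/-! ### Replacing a complex by one with acyclic terms. -/

section Resolution

variable {k : Type t} [Field k] {A : Type u} [Category.{v} A] [Abelian A] [Linear k A]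
  [HasExt.{w} A] (hA : IsExtFinite k A) {T : A}

include hA in
-- Keeping zero objects zero makes resolutions of bounded complexes bounded.
lemma exists_mono_isExtAcyclic' (hT : IsTilting T) (X : A) :
    ∃ (Y : A) (i : X ⟶ Y), Mono i ∧ IsExtAcyclic T Y ∧ (IsZero X → IsZero Y) := by
  by_cases hX : IsZero X
  · exact ⟨X, 𝟙 X, inferInstance, IsExtAcyclic.of_isZero hX, id⟩
  · obtain ⟨Y, i, hi, hY⟩ := exists_mono_isExtAcyclic hA hT.ext_one_self X
    exact ⟨Y, i, hi, hY, fun h => (hX h).elim⟩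

open CochainComplex HomComplex in
include hA in
/-- Every complex embeds in a contractible complex with `T`-acyclic terms. -/
lemma exists_mono_contractible (hT : IsTilting T) (Y : CochainComplex A ℤ) :
    ∃ (J : CochainComplex A ℤ) (f : Y ⟶ J), (∀ n, Mono (f.f n)) ∧
      (∀ n, IsExtAcyclic T (J.X n)) ∧ IsZero ((HomotopyCategory.quotient A _).obj J) ∧
      ∀ n, IsZero (Y.X n) → IsZero (Y.X (n + 1)) → IsZero (J.X n) := by
  choose I ι hι hI hI' using fun n => exists_mono_isExtAcyclic' hA hT (Y.X n)
  let L : CochainComplex A ℤ := { X := I, d := fun _ _ => 0 }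
  -- The cone of the identity of `L` has terms I (n + 1) ⊕ I n. The component `ι` into I n makes the
  -- map mono; the other component -δβ is then forced by compatibility with the differentials.
  let β : Cochain Y L 0 := Cochain.ofHoms ι
  let α : Cocycle Y L 1 := Cocycle.mk (-δ 0 1 β) 2 rfl (by rw [δ_neg, δ_δ, neg_zero])
  let f : Y ⟶ mappingCone (𝟙 L) := mappingCone.lift _ α β (by simp [α])
  refine ⟨mappingCone (𝟙 L), f, fun n => ?_, isExtAcyclic_mappingCone _ hI hI, ?_, fun n h h' => ?_⟩
  · have : f.f n ≫ (mappingCone.snd (𝟙 L)).v n n (add_zero n) = ι n := by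
      simp [f, β]
    have : Mono (f.f n ≫ (mappingCone.snd (𝟙 L)).v n n (add_zero n)) := by
      rw [this]
      exact hι n
    exact mono_of_mono _ ((mappingCone.snd (𝟙 L)).v n n (add_zero n))
  · have hD : mappingCone.triangleh (𝟙 L) ∈ distTriang _ := ⟨_, _, _, ⟨Iso.refl _⟩⟩
    refine Triangle.isZero₃_of_isIso₁ _ hD ?_
    change IsIso ((HomotopyCategory.quotient A _).map (𝟙 L))
    infer_instance
  · rw [IsZero.iff_id_eq_zero, ← mappingCone.id_X (𝟙 L) n (n + 1) rfl,
      (hI' n h).eq_of_tgt ((mappingCone.snd (𝟙 L)).v n n (add_zero n)) 0,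
      (hI' (n + 1) h').eq_of_tgt ((mappingCone.fst (𝟙 L)).1.v n (n + 1) rfl) 0]
    simp

variable [HasDerivedCategory.{w₁} A]

include hA in
/-- Every complex is quasi-isomorphic to a complex with `T`-acyclic terms. -/
lemma exists_isIso_Qh_map_extAcyclic (hT : IsTilting T)
    (Y : HomotopyCategory A (ComplexShape.up ℤ)) :
    ∃ (L : HomotopyCategory A (ComplexShape.up ℤ)) (s : Y ⟶ L),
      IsIso (DerivedCategory.Qh.map s) ∧ extAcyclicComplexes T L ∧
      ∀ n, IsZero (Y.as.X (n - 1)) → IsZero (Y.as.X n) → IsZero (L.as.X n) := by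
  have := hT.hasProjectiveDimensionLE_one
  obtain ⟨Y : CochainComplex A ℤ, rfl⟩ := Y.quotient_obj_surjective
  -- Embed Y[-1] in a contractible `J`. Then Y is homotopy equivalent to the cone of the embedding,
  -- which is quasi-isomorphic to its cokernel, and the cokernel has acyclic terms as a quotient of
  -- `J`.
  let Y' : CochainComplex A ℤ := Y⟦(-1 : ℤ)⟧
  obtain ⟨J, f, hf, hJ, hJ₀, hJ'⟩ := exists_mono_contractible hA hT Y'
  have : Mono f := HomologicalComplex.mono_of_mono_f f hf
  have hS : (ShortComplex.mk f (cokernel.π f) (by simp)).ShortExact :=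
    { exact := ShortComplex.exact_cokernel f }
  have hq := CochainComplex.mappingCone.quasiIso_descShortComplex hS
  have hD : CochainComplex.mappingCone.triangleh f ∈ distTriang _ := ⟨_, _, f, ⟨Iso.refl _⟩⟩
  have hiso : IsIso (CochainComplex.mappingCone.triangleh f).mor₃ :=
    (Triangle.isZero₂_iff_isIso₃ _ hD).1 hJ₀
  let e : (HomotopyCategory.quotient A _).obj Y ≅
      (HomotopyCategory.quotient A _).obj (CochainComplex.mappingCone f) :=
    (HomotopyCategory.quotient A _).mapIso
      ((shiftFunctorCompIsoId _ (-1 : ℤ) 1 (by lia)).symm.app Y) ≪≫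
      ((HomotopyCategory.quotient A _).commShiftIso (1 : ℤ)).app Y' ≪≫
      (asIso (CochainComplex.mappingCone.triangleh f).mor₃).symm
  have hepi (n : ℤ) : Epi ((cokernel.π f).f n) :=
    inferInstanceAs (Epi ((HomologicalComplex.eval A _ n).map (cokernel.π f)))
  have hC (n : ℤ) : IsExtAcyclic T ((cokernel f).X n) := (hJ n).of_epi ((cokernel.π f).f n)
  have hC' (n : ℤ) (h : IsZero (J.X n)) : IsZero ((cokernel f).X n) :=
    h.of_epi ((cokernel.π f).f n)
  refine ⟨(HomotopyCategory.quotient A _).obj (cokernel f), e.hom ≫ (HomotopyCategory.quotient A _).map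
    (CochainComplex.mappingCone.descShortComplex (ShortComplex.mk f (cokernel.π f) (by simp))),
    ?_, hC, fun n h h' => ?_⟩
  · rw [Functor.map_comp]
    have : IsIso (DerivedCategory.Qh.map ((HomotopyCategory.quotient A _).map
      (CochainComplex.mappingCone.descShortComplex (ShortComplex.mk f (cokernel.π f) (by simp))))) := by
      rw [DerivedCategory.isIso_Qh_map_iff, HomotopyCategory.quotient_map_mem_quasiIso_iff]
      exact hq
    infer_instance
  · refine hC' n (hJ' n ?_ ?_)
    · exact h
    · change IsZero (Y.X (n + 1 + -1))
      rwa [add_neg_cancel_right]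

end Resolution

/-! ### Adjunctions on homotopy categories; projectives as summands of free modules. -/

section

variable {C : Type u} [Category.{v} C] [Preadditive C] {D : Type u'} [Category.{v'} D]
  [Preadditive D] {F : C ⥤ D} {G : D ⥤ C} [F.Additive] [G.Additive]

/-- The adjunction on homotopy categories induced by an adjunction between additive functors. -/
def mapHomotopyCategoryAdjunction (adj : F ⊣ G) :
    F.mapHomotopyCategory (ComplexShape.up ℤ) ⊣ G.mapHomotopyCategory (ComplexShape.up ℤ) where
  unit :=
    { app K := (HomotopyCategory.quotient _ _).map {
        f := fun n => adj.unit.app (K.as.X n)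
        comm' := fun i j _ => (adj.unit.naturality (K.as.d i j)).symm }
      naturality K L f := by
        obtain ⟨f, rfl⟩ := (HomotopyCategory.quotient _ _).map_surjective f
        refine ((HomotopyCategory.quotient _ _).map_comp _ _).symm.trans
          (Eq.trans ?_ ((HomotopyCategory.quotient _ _).map_comp _ _))
        congr 1
        ext n
        exact adj.unit.naturality (f.f n) }
  counit :=
    { app K := (HomotopyCategory.quotient _ _).map {
        f := fun n => adj.counit.app (K.as.X n)
        comm' := fun i j _ => (adj.counit.naturality (K.as.d i j)).symm }
      naturality K L f := by
        obtain ⟨f, rfl⟩ := (HomotopyCategory.quotient _ _).map_surjective f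
        refine ((HomotopyCategory.quotient _ _).map_comp _ _).symm.trans
          (Eq.trans ?_ ((HomotopyCategory.quotient _ _).map_comp _ _))
        congr 1
        ext n
        exact adj.counit.naturality (f.f n) }
  left_triangle_components K := by
    refine ((HomotopyCategory.quotient _ _).map_comp _ _).symm.trans
      (Eq.trans ?_ ((HomotopyCategory.quotient _ _).map_id _))
    congr 1
    ext n
    exact adj.left_triangle_components (K.as.X n)
  right_triangle_components K := by
    refine ((HomotopyCategory.quotient _ _).map_comp _ _).symm.trans
      (Eq.trans ?_ ((HomotopyCategory.quotient _ _).map_id _))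
    congr 1
    ext n
    exact adj.right_triangle_components (K.as.X n)

lemma isIso_mapHomotopyCategoryAdjunction_unit_app (adj : F ⊣ G)
    (K : HomotopyCategory C (ComplexShape.up ℤ)) (hK : ∀ n, IsIso (adj.unit.app (K.as.X n))) :
    IsIso ((mapHomotopyCategoryAdjunction adj).unit.app K) := by
  let φ : K.as ⟶ (G.mapHomologicalComplex _).obj ((F.mapHomologicalComplex _).obj K.as) :=
    { f := fun n => adj.unit.app (K.as.X n)
      comm' := fun i j _ => (adj.unit.naturality (K.as.d i j)).symm }
  have (n : ℤ) : IsIso (φ.f n) := hK n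
  have : IsIso φ := HomologicalComplex.Hom.isIso_of_components φ
  exact inferInstanceAs (IsIso ((HomotopyCategory.quotient _ _).map φ))

/-- `M` is a retract of a finite power of `X`; conjugating the inverse at `X` by the coordinate maps
and summing gives the inverse at `M`. -/
lemma isIso_app_of_decomposition {F G : C ⥤ D} [F.Additive] [G.Additive] (τ : F ⟶ G) {X M : C}
    {n : ℕ} (p : Fin n → (M ⟶ X)) (i : Fin n → (X ⟶ M)) (h : ∑ j, p j ≫ i j = 𝟙 M)
    [IsIso (τ.app X)] : IsIso (τ.app M) := by
  refine ⟨∑ j, G.map (p j) ≫ inv (τ.app X) ≫ F.map (i j), ?_, ?_⟩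
  · rw [Preadditive.comp_sum, ← F.map_id, ← h, F.map_sum]
    refine Finset.sum_congr rfl fun j _ => ?_
    rw [← τ.naturality_assoc, IsIso.hom_inv_id_assoc, F.map_comp]
  · rw [Preadditive.sum_comp, ← G.map_id, ← h, G.map_sum]
    refine Finset.sum_congr rfl fun j _ => ?_
    rw [assoc, assoc, τ.naturality, IsIso.inv_hom_id_assoc, G.map_comp]

end

lemma exists_decomposition_of_projective (R : Type u) [Ring R] [IsNoetherianRing R]
    (M : FGModuleCat.{u} R) [Projective M] :
    ∃ (n : ℕ) (p : Fin n → (M ⟶ FGModuleCat.of R R)) (i : Fin n → (FGModuleCat.of R R ⟶ M)),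
      ∑ j, p j ≫ i j = 𝟙 M := by
  obtain ⟨n, f, hf⟩ := exists_epi_fg R M
  let s := Projective.factorThru (𝟙 M) f
  refine ⟨n, fun j => s ≫ FGModuleCat.ofHom (LinearMap.proj j),
    fun j => FGModuleCat.ofHom (LinearMap.single R (fun _ => R) j) ≫ f, ?_⟩
  have h : ∑ j : Fin n, FGModuleCat.ofHom (LinearMap.proj (R := R) (φ := fun _ : Fin n => R) j) ≫
      FGModuleCat.ofHom (LinearMap.single R (fun _ => R) j) = 𝟙 (FGModuleCat.of R (Fin n → R)) := by
    apply FGModuleCat.hom_ext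
    refine LinearMap.ext fun x => ?_
    have (y : Fin n → R) : ∑ j, Pi.single j (y j) = y := Finset.univ_sum_single y
    let ev : (FGModuleCat.of R (Fin n → R) ⟶ FGModuleCat.of R (Fin n → R)) →+ (Fin n → R) :=
      AddMonoidHom.mk' (fun g => g.hom.hom x) fun _ _ => rfl
    exact (map_sum ev _ _).trans (this x)
  calc _ = s ≫ (∑ j : Fin n, FGModuleCat.ofHom (LinearMap.proj (R := R) (φ := fun _ : Fin n => R) j) ≫
      FGModuleCat.ofHom (LinearMap.single R (fun _ => R) j)) ≫ f := by
        simp only [Preadditive.sum_comp, Preadditive.comp_sum, assoc]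
    _ = 𝟙 M := by
        rw [h, id_comp]
        exact Projective.factorThru_comp _ _

/-! ### The unit of the adjunction on projective modules. -/

section

variable {k : Type t} [Field k] {A : Type u} [Category.{v} A] [Abelian A] [Linear k A]
  [HasExt.{w} A] (hA : IsExtFinite k A) {T : A} [IsNoetherianRing (End T)ᵐᵒᵖ]

variable (T) in
/-- The image of `1` under `Λ ⟶ Hom(T, Λ ⊗ T)`. -/
def toTensorUnit : T ⟶ (tensorFunctor hA T).obj (FGModuleCat.of _ (End T)ᵐᵒᵖ) :=
  ((tensorHomAdjunction hA T).unit.app (FGModuleCat.of _ (End T)ᵐᵒᵖ)).hom.hom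
    (1 : (End T)ᵐᵒᵖ)

/-- By Yoneda: Hom(Λ ⊗ T, Y) ≅ Hom(Λ, Hom(T, Y)) ≅ Hom(T, Y), and the composite is precomposition
with this map. -/
instance : IsIso (toTensorUnit hA T) := by
  refine isIso_of_coyoneda_map_bijective _ fun Y => ?_
  have h1 := ((tensorHomAdjunction hA T).homEquiv (FGModuleCat.of _ (End T)ᵐᵒᵖ) Y).bijective
  have := hA.finite_hom_end T Y
  have h2 : Function.Bijective (fun f : FGModuleCat.of (End T)ᵐᵒᵖ (End T)ᵐᵒᵖ ⟶
      (homFunctor hA T).obj Y => (f.hom.hom (1 : (End T)ᵐᵒᵖ) : T ⟶ Y)) := by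
    constructor
    · intro f g h
      apply FGModuleCat.hom_ext
      exact LinearMap.ext_ring h
    · intro y
      refine ⟨FGModuleCat.ofHom (LinearMap.toSpanSingleton (End T)ᵐᵒᵖ
        (T ⟶ Y) y), ?_⟩
      exact one_smul (End T)ᵐᵒᵖ (show T ⟶ Y from y)
  exact h2.comp h1

instance : IsIso ((tensorHomAdjunction hA T).unit.app (FGModuleCat.of _ (End T)ᵐᵒᵖ)) := by
  let φ := (tensorHomAdjunction hA T).unit.app (FGModuleCat.of _ (End T)ᵐᵒᵖ)
  have h (r : (End T)ᵐᵒᵖ) : (φ.hom.hom r : T ⟶ _) = r.unop ≫ toTensorUnit hA T := by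
    have := φ.hom.hom.map_smul r (1 : (End T)ᵐᵒᵖ)
    rw [smul_eq_mul, mul_one] at this
    exact this
  have hφ : Function.Bijective φ.hom.hom := by
    constructor
    · intro r s hrs
      apply MulOpposite.unop_injective
      rw [← cancel_mono (toTensorUnit hA T)]
      exact (h r).symm.trans (hrs.trans (h s))
    · intro x
      refine ⟨MulOpposite.op ((show T ⟶ _ from x) ≫ inv (toTensorUnit hA T)), ?_⟩
      have hx (y : T ⟶ (tensorFunctor hA T).obj (FGModuleCat.of _ (End T)ᵐᵒᵖ)) :
          (y ≫ inv (toTensorUnit hA T)) ≫ toTensorUnit hA T = y := by simp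
      exact (h _).trans (hx x)
  have : IsIso ((forget₂ (FGModuleCat.{v} (End T)ᵐᵒᵖ) (ModuleCat.{v} (End T)ᵐᵒᵖ)).map φ) :=
    (ConcreteCategory.isIso_iff_bijective _).2 hφ
  exact isIso_of_reflects_iso φ (forget₂ (FGModuleCat.{v} (End T)ᵐᵒᵖ) (ModuleCat.{v} (End T)ᵐᵒᵖ))

lemma isIso_unit_app_of_projective (P : FGModuleCat.{v} (End T)ᵐᵒᵖ) [Projective P] :
    IsIso ((tensorHomAdjunction hA T).unit.app P) := by
  obtain ⟨n, p, i, h⟩ := exists_decomposition_of_projective _ P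
  exact isIso_app_of_decomposition _ p i h

lemma isExtAcyclic_tensorFunctor_obj (hT : IsExtAcyclic T T) (P : FGModuleCat.{v} (End T)ᵐᵒᵖ)
    [Projective P] : IsExtAcyclic T ((tensorFunctor hA T).obj P) := by
  obtain ⟨n, p, i, h⟩ := exists_decomposition_of_projective _ P
  have hR := hT.of_iso (asIso (toTensorUnit hA T))
  intro x
  rw [← Abelian.Ext.comp_mk₀_id x, ← CategoryTheory.Functor.map_id, ← h, Functor.map_sum]
  refine Finset.sum_induction _ (fun f => x.comp (Abelian.Ext.mk₀ f) (add_zero 1) = 0)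
    (fun f g hf hg => ?_) (by simp) (fun j _ => ?_)
  · rw [Abelian.Ext.mk₀_add, Abelian.Ext.comp_add, hf, hg, add_zero]
  · rw [Functor.map_comp, ← Abelian.Ext.mk₀_comp_mk₀, ← Abelian.Ext.comp_assoc_of_third_deg_zero,
      hR (x.comp _ _), Abelian.Ext.zero_comp]

end

/-! ### Right bounded complexes of projectives. -/

section

variable {C : Type u} [Category.{v} C] [Abelian C]

/-- Complexes of projective objects that vanish in large degrees. -/
def projMinus : ObjectProperty (HomotopyCategory C (ComplexShape.up ℤ)) :=
  fun K => (∀ n : ℤ, Projective (K.as.X n)) ∧ ∃ n : ℤ, ∀ i : ℤ, n < i → IsZero (K.as.X i)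

lemma projMinusBounded.projMinus {K : HomotopyCategory C (ComplexShape.up ℤ)}
    (hK : projMinusBounded C K) : projMinus K :=
  ⟨hK.1, hK.2.1⟩

variable [HasDerivedCategory.{w} C]

lemma projMinus.Qh_map_bijective {P : HomotopyCategory C (ComplexShape.up ℤ)} (hP : projMinus P)
    (M : HomotopyCategory C (ComplexShape.up ℤ)) :
    Function.Bijective (DerivedCategory.Qh.map : (P ⟶ M) → _) := by
  obtain ⟨h1, ⟨n, h2⟩⟩ := hP
  have := (CochainComplex.isStrictlyLE_iff P.as n).2 h2
  have : CochainComplex.IsKProjective P.as := CochainComplex.isKProjective_of_projective _ n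
  exact CochainComplex.IsKProjective.Qh_map_bijective P.as M

lemma projMinus.comp_bijective {P : HomotopyCategory C (ComplexShape.up ℤ)} (hP : projMinus P)
    {M N : HomotopyCategory C (ComplexShape.up ℤ)} (s : M ⟶ N)
    (hs : IsIso (DerivedCategory.Qh.map s)) :
    Function.Bijective (fun f : P ⟶ M => f ≫ s) := by
  rw [← Function.Bijective.of_comp_iff' (hP.Qh_map_bijective N)]
  have h : Function.Bijective (fun f : DerivedCategory.Qh.obj P ⟶ DerivedCategory.Qh.obj M =>
      f ≫ DerivedCategory.Qh.map s) := (asIso (DerivedCategory.Qh.map s)).homToEquiv.bijective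
  convert h.comp (hP.Qh_map_bijective M) using 1
  ext f
  simp

end

/-! ### Morphisms out of P ⊗ T in the derived category. -/

section

variable {k : Type t} [Field k] {A : Type u} [Category.{v} A] [Abelian A] [Linear k A]
  [HasExt.{w} A] (hA : IsExtFinite k A) {T : A} [IsNoetherianRing (End T)ᵐᵒᵖ]

variable (T) in
/-- The functor `- ⊗_Λ T` on homotopy categories. -/
abbrev tensorComplex : HomotopyCategory (FGModuleCat.{v} (End T)ᵐᵒᵖ) (ComplexShape.up ℤ) ⥤
    HomotopyCategory A (ComplexShape.up ℤ) :=
  (tensorFunctor hA T).mapHomotopyCategory (ComplexShape.up ℤ)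

variable (T) in
/-- The functor `Hom(T, -)` on homotopy categories. -/
abbrev homComplex : HomotopyCategory A (ComplexShape.up ℤ) ⥤
    HomotopyCategory (FGModuleCat.{v} (End T)ᵐᵒᵖ) (ComplexShape.up ℤ) :=
  (homFunctor hA T).mapHomotopyCategory (ComplexShape.up ℤ)

variable (T) in
/-- The adjunction between `- ⊗_Λ T` and `Hom(T, -)` on homotopy categories. -/
abbrev complexAdjunction : tensorComplex hA T ⊣ homComplex hA T :=
  mapHomotopyCategoryAdjunction (tensorHomAdjunction hA T)

lemma projMinus.isIso_unit_app {P : HomotopyCategory (FGModuleCat.{v} (End T)ᵐᵒᵖ) (ComplexShape.up ℤ)}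
    (hP : projMinus P) : IsIso ((complexAdjunction hA T).unit.app P) :=
  isIso_mapHomotopyCategoryAdjunction_unit_app _ _ fun n =>
    have := hP.1 n
    isIso_unit_app_of_projective hA _

lemma projMinus.extAcyclicComplexes_tensor (hT : IsTilting T)
    {P : HomotopyCategory (FGModuleCat.{v} (End T)ᵐᵒᵖ) (ComplexShape.up ℤ)} (hP : projMinus P) :
    extAcyclicComplexes T ((tensorComplex hA T).obj P) := fun n =>
  have := hP.1 n
  isExtAcyclic_tensorFunctor_obj hA hT.ext_one_self _

variable [HasDerivedCategory.{w₁} A]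

section

variable [HasDerivedCategory.{w₂} (FGModuleCat.{v} (End T)ᵐᵒᵖ)]

/-- A morphism `P ⊗ T ⟶ Y`, where `P` is a right bounded complex of projectives and `Y` has
`T`-acyclic terms, is a quasi-isomorphism if and only if `P ⟶ Hom(T, Y)` is. -/
lemma IsTilting.isIso_Qh_map_homEquiv_iff (hT : IsTilting T)
    {P : HomotopyCategory (FGModuleCat.{v} (End T)ᵐᵒᵖ) (ComplexShape.up ℤ)} (hP : projMinus P)
    {Y : HomotopyCategory A (ComplexShape.up ℤ)} (hY : extAcyclicComplexes T Y)
    (f : (tensorComplex hA T).obj P ⟶ Y) :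
    IsIso (DerivedCategory.Qh.map ((complexAdjunction hA T).homEquiv _ _ f)) ↔
      IsIso (DerivedCategory.Qh.map f) := by
  have := hP.isIso_unit_app hA
  rw [← hT.isIso_Qh_map_homFunctor_iff hA f (hP.extAcyclicComplexes_tensor hA hT) hY,
    Adjunction.homEquiv_unit, Functor.map_comp]
  exact isIso_comp_left_iff _ _

end

/-- By adjunction this concerns maps from P to Hom(T, Y); there Hom(T, s) is a quasi-isomorphism and
P is K-projective. -/
lemma IsTilting.comp_bijective (hT : IsTilting T)
    {P : HomotopyCategory (FGModuleCat.{v} (End T)ᵐᵒᵖ) (ComplexShape.up ℤ)} (hP : projMinus P)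
    {Y Y' : HomotopyCategory A (ComplexShape.up ℤ)} (s : Y ⟶ Y')
    (hY : extAcyclicComplexes T Y) (hY' : extAcyclicComplexes T Y')
    (hs : IsIso (DerivedCategory.Qh.map s)) :
    Function.Bijective (fun f : (tensorComplex hA T).obj P ⟶ Y => f ≫ s) := by
  let := HasDerivedCategory.standard (FGModuleCat.{v} (End T)ᵐᵒᵖ)
  rw [← Function.Bijective.of_comp_iff' ((complexAdjunction hA T).homEquiv P Y').bijective]
  have h := (hP.comp_bijective ((homComplex hA T).map s)
    ((hT.isIso_Qh_map_homFunctor_iff hA s hY hY').2 hs)).comp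
    ((complexAdjunction hA T).homEquiv P Y).bijective
  convert h using 1
  ext f
  exact (complexAdjunction hA T).homEquiv_naturality_right f s

/-- Morphisms from `P ⊗ T` in the derived category to a complex with `T`-acyclic terms. -/
lemma IsTilting.Qh_map_bijective (hT : IsTilting T)
    {P : HomotopyCategory (FGModuleCat.{v} (End T)ᵐᵒᵖ) (ComplexShape.up ℤ)} (hP : projMinus P)
    {Y : HomotopyCategory A (ComplexShape.up ℤ)} (hY : extAcyclicComplexes T Y) :
    Function.Bijective (DerivedCategory.Qh.map : ((tensorComplex hA T).obj P ⟶ Y) → _) := by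
  constructor
  · intro f g hfg
    obtain ⟨Y', s, hs, h⟩ := (MorphismProperty.map_eq_iff_postcomp DerivedCategory.Qh
      (HomotopyCategory.quasiIso A (ComplexShape.up ℤ)) f g).1 hfg
    rw [← DerivedCategory.isIso_Qh_map_iff] at hs
    -- The middle term of a fraction need not have acyclic terms; pushing it on to a resolution
    -- makes `IsTilting.comp_bijective` applicable.
    obtain ⟨L, t, ht, hL, -⟩ := exists_isIso_Qh_map_extAcyclic hA hT Y'
    refine (hT.comp_bijective hA hP (s ≫ t) hY hL ?_).injective ?_
    · rw [Functor.map_comp]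
      infer_instance
    · simp only [← assoc, h]
  · intro φ
    obtain ⟨ψ, hψ⟩ := Localization.exists_leftFraction DerivedCategory.Qh
      (HomotopyCategory.quasiIso A (ComplexShape.up ℤ)) φ
    obtain ⟨Y', g, s, hs, rfl⟩ := ψ.cases
    rw [← DerivedCategory.isIso_Qh_map_iff] at hs
    obtain ⟨L, t, ht, hL, -⟩ := exists_isIso_Qh_map_extAcyclic hA hT Y'
    obtain ⟨f, hf⟩ := (hT.comp_bijective hA hP (s ≫ t) hY hL (by
      rw [Functor.map_comp]
      infer_instance)).surjective (g ≫ t)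
    refine ⟨f, ?_⟩
    rw [hψ, MorphismProperty.LeftFraction.map]
    dsimp only at hf ⊢
    rw [← cancel_mono (DerivedCategory.Qh.map s), ← cancel_mono (DerivedCategory.Qh.map t)]
    simp only [assoc, ← Functor.map_comp, hf]
    rw [Functor.map_comp, Functor.map_comp, IsIso.inv_hom_id_assoc]

end

/-! ### Bounded cohomology, full faithfulness and essential surjectivity. -/

section

lemma isZero_homologyFunctor_quotient_iff {C : Type u} [Category.{v} C] [Abelian C]
    (K : CochainComplex C ℤ) (n : ℤ) :
    IsZero ((HomotopyCategory.homologyFunctor C (ComplexShape.up ℤ) n).obj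
      ((HomotopyCategory.quotient C _).obj K)) ↔ K.ExactAt n := by
  rw [HomologicalComplex.exactAt_iff_isZero_homology]
  exact ((HomotopyCategory.homologyFunctorFactors C _ n).app K).isZero_iff

variable {k : Type t} [Field k] {A : Type u} [Category.{v} A] [Abelian A] [Linear k A]
  [HasExt.{w} A] (hA : IsExtFinite k A) {T : A} [IsNoetherianRing (End T)ᵐᵒᵖ]

lemma projMinus.tensorComplex_map_bijective
    {P Q : HomotopyCategory (FGModuleCat.{v} (End T)ᵐᵒᵖ) (ComplexShape.up ℤ)}
    (hQ : projMinus Q) :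
    Function.Bijective ((tensorComplex hA T).map : (P ⟶ Q) → _) := by
  have := hQ.isIso_unit_app hA
  rw [← Function.Bijective.of_comp_iff' ((complexAdjunction hA T).homEquiv P _).bijective]
  have h : Function.Bijective (fun f : P ⟶ Q => f ≫ (complexAdjunction hA T).unit.app Q) :=
    (asIso ((complexAdjunction hA T).unit.app Q)).homToEquiv.bijective
  convert h using 1
  ext f
  exact ((complexAdjunction hA T).homEquiv_unit _ _ _).trans
    ((complexAdjunction hA T).unit.naturality f).symm

/-- As Hom(T, P ⊗ T) ≅ P, exactness of P in degrees n and n + 1 gives exactness of P ⊗ T in degree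
n. -/
lemma IsTilting.finite_homology_tensor (hT : IsTilting T)
    {P : HomotopyCategory (FGModuleCat.{v} (End T)ᵐᵒᵖ) (ComplexShape.up ℤ)}
    (hP : projMinusBounded _ P) :
    {n : ℤ | ¬ IsZero ((HomotopyCategory.homologyFunctor A (ComplexShape.up ℤ) n).obj
      ((tensorComplex hA T).obj P))}.Finite := by
  have h := hP.2.2
  refine (h.union (h.image (fun n => n - 1))).subset fun n hn => ?_
  by_contra hn'
  rw [Set.mem_union, not_or] at hn'
  refine hn ((isZero_homologyFunctor_quotient_iff
    (((tensorFunctor hA T).mapHomologicalComplex _).obj P.as) n).2 ?_)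
  have := hP.projMinus.isIso_unit_app hA
  have key (m : ℤ) (hm : IsZero ((HomotopyCategory.homologyFunctor _ _ m).obj P)) :
      (((homFunctor hA T).mapHomologicalComplex (ComplexShape.up ℤ)).obj
        (((tensorFunctor hA T).mapHomologicalComplex (ComplexShape.up ℤ)).obj P.as)).ExactAt m := by
    rw [← isZero_homologyFunctor_quotient_iff]
    exact hm.of_iso ((HomotopyCategory.homologyFunctor _ _ m).mapIso
      (asIso ((complexAdjunction hA T).unit.app P))).symm
  refine hT.exactAt_of_homFunctor hA _ (hP.projMinus.extAcyclicComplexes_tensor hA hT) n (n + 1) rfl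
    (key _ ?_) (key _ ?_)
  · simpa using hn'.1
  · by_contra h'
    exact hn'.2 ⟨n + 1, h', by simp⟩

variable [HasDerivedCategory.{w₁} A]

lemma IsTilting.exists_projMinusBounded_iso (hT : IsTilting T) (X : DerivedCategory A)
    (hX : DerivedCategory.TStructure.t.bounded X) :
    ∃ P, projMinusBounded (FGModuleCat.{v} (End T)ᵐᵒᵖ) P ∧
      Nonempty (DerivedCategory.Qh.obj ((tensorComplex hA T).obj P) ≅ X) := by
  let := HasDerivedCategory.standard (FGModuleCat.{v} (End T)ᵐᵒᵖ)
  have := hT.hasProjectiveDimensionLE_one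
  obtain ⟨b, (hb : X.IsLE b)⟩ := hX.2
  obtain ⟨K, hK, ⟨e⟩⟩ := X.exists_iso_Q_obj_of_isLE b
  obtain ⟨L, s, hs, hL, hL₀⟩ := exists_isIso_Qh_map_extAcyclic hA hT
    ((HomotopyCategory.quotient A _).obj K)
  let e' : DerivedCategory.Qh.obj L ≅ X := (asIso (DerivedCategory.Qh.map s)).symm ≪≫
    (DerivedCategory.quotientCompQhIso A).app K ≪≫ e.symm
  have hLb := (bounded_Qh_iff A L).1 (ObjectProperty.prop_of_iso _ e'.symm hX)
  let HL : CochainComplex (FGModuleCat.{v} (End T)ᵐᵒᵖ) ℤ :=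
    ((homFunctor hA T).mapHomologicalComplex (ComplexShape.up ℤ)).obj L.as
  -- The resolution `L` may reach one degree further to the right than `K`.
  have hHL : HL.IsStrictlyLE (b + 1) := by
    rw [CochainComplex.isStrictlyLE_iff]
    intro i hi
    exact (homFunctor hA T).map_isZero (hL₀ i (K.isZero_of_isStrictlyLE b (i - 1) (by lia))
      (K.isZero_of_isStrictlyLE b i (by lia)))
  obtain ⟨P, g, hg, hP, hP₀⟩ := exists_quasiIso_projective HL (b + 1)
  have hgK : IsIso (DerivedCategory.Qh.map ((HomotopyCategory.quotient _ _).map g)) := by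
    rw [DerivedCategory.isIso_Qh_map_iff, HomotopyCategory.quotient_map_mem_quasiIso_iff]
    exact hg
  let g' : (HomotopyCategory.quotient _ _).obj P ⟶ (homComplex hA T).obj L :=
    (HomotopyCategory.quotient _ _).map g
  let f := ((complexAdjunction hA T).homEquiv _ _).symm g'
  have hPm : projMinus ((HomotopyCategory.quotient _ _).obj P) := ⟨hP, ⟨b + 1, hP₀⟩⟩
  have hf : IsIso (DerivedCategory.Qh.map f) := by
    rw [← hT.isIso_Qh_map_homEquiv_iff hA hPm hL, Equiv.apply_symm_apply]
    exact hgK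
  refine ⟨(HomotopyCategory.quotient _ _).obj P, ⟨hP, ⟨b + 1, hP₀⟩, ?_⟩,
    ⟨asIso (DerivedCategory.Qh.map f) ≪≫ e'⟩⟩
  -- The cohomology of P is that of Hom(T, L), which vanishes in degree n once `L` is exact in
  -- degrees n - 1 and n.
  refine (hLb.union (hLb.image (fun n => n + 1))).subset fun n hn => ?_
  by_contra hn'
  rw [Set.mem_union, not_or] at hn'
  refine hn ((isZero_homologyFunctor_quotient_iff P n).2 ?_)
  have key (m : ℤ) (hm : IsZero ((HomotopyCategory.homologyFunctor _ _ m).obj L)) :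
      L.as.ExactAt m := (isZero_homologyFunctor_quotient_iff L.as m).1 hm
  have hHLn : HL.ExactAt n := by
    refine homFunctor_exactAt hA L.as hL (n - 1) n (by lia) (key _ ?_) (key _ ?_)
    · by_contra h'
      exact hn'.2 ⟨n - 1, h', by simp⟩
    · simpa using hn'.1
  rw [HomologicalComplex.exactAt_iff_isZero_homology] at hHLn ⊢
  exact hHLn.of_iso (asIso (HomologicalComplex.homologyMap g n))

variable [HasDerivedCategory.{w₂} (FGModuleCat.{v} (End T)ᵐᵒᵖ)]

lemma IsTilting.bounded_derivedTensor (hT : IsTilting T)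
    (X : DerivedCategory.Bounded (FGModuleCat.{v} (End T)ᵐᵒᵖ)) :
    DerivedCategory.TStructure.t.bounded ((derivedTensor hA T).obj X) :=
  (bounded_Qh_iff A _).2 (hT.finite_homology_tensor hA ((projToDerived _).inv.obj X).property)

lemma IsTilting.derivedTensor_isEquivalence (hT : IsTilting T) :
    (derivedTensorBounded hA T (hT.bounded_derivedTensor hA)).IsEquivalence := by
  let Φ : (projMinusBounded (FGModuleCat.{v} (End T)ᵐᵒᵖ)).FullSubcategory ⥤ DerivedCategory A :=
    (projMinusBounded _).ι ⋙ tensorComplex hA T ⋙ DerivedCategory.Qh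
  have hΦ (P Q : (projMinusBounded (FGModuleCat.{v} (End T)ᵐᵒᵖ)).FullSubcategory) :
      Function.Bijective (Φ.map : (P ⟶ Q) → _) :=
    ((hT.Qh_map_bijective hA P.property.projMinus
      (Q.property.projMinus.extAcyclicComplexes_tensor hA hT)).comp
      (Q.property.projMinus.tensorComplex_map_bijective hA)).comp
      ((projMinusBounded _).fullyFaithfulι.map_bijective P Q)
  have : Φ.Full := ⟨fun f => (hΦ _ _).surjective f⟩
  have : Φ.Faithful := ⟨fun h => (hΦ _ _).injective h⟩
  have : (derivedTensor hA T).Full := inferInstanceAs ((projToDerived _).inv ⋙ Φ).Full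
  have : (derivedTensor hA T).Faithful := inferInstanceAs ((projToDerived _).inv ⋙ Φ).Faithful
  have : (derivedTensorBounded hA T (hT.bounded_derivedTensor hA)).EssSurj := by
    refine ⟨fun X => ?_⟩
    obtain ⟨P, hP, ⟨e⟩⟩ := hT.exists_projMinusBounded_iso hA X.obj X.property
    refine ⟨(projToDerived _).obj ⟨P, hP⟩, ⟨ObjectProperty.isoMk _ ?_⟩⟩
    exact Φ.mapIso ((projToDerived _).asEquivalence.unitIso.symm.app ⟨P, hP⟩) ≪≫ e
  exact { }

end

/-! ### Compatibility with triangles. -/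

section

variable {C : Type u} [Category.{v} C] [Abelian C]

/-- The third vertex is a cone, whose terms are sums of projectives; its cohomology is bounded
because the bounded derived category is closed under triangles. -/
instance : (projMinusBounded C).IsTriangulatedClosed₃ where
  ext₃' D hD h₁ h₂ := by
    let := HasDerivedCategory.standard C
    obtain ⟨f, hf⟩ := (HomotopyCategory.quotient C _).map_surjective
      (X := D.obj₁.as) (Y := D.obj₂.as) D.mor₁
    have hE : CochainComplex.mappingCone.triangleh f ∈ distTriang _ := ⟨_, _, f, ⟨Iso.refl _⟩⟩
    refine ⟨(HomotopyCategory.quotient C _).obj (CochainComplex.mappingCone f), ⟨fun n => ?_, ?_, ?_⟩,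
      ⟨Triangle.π₃.mapIso (isoTriangleOfIso₁₂ D _ hD hE (Iso.refl _) (Iso.refl _) ?_)⟩⟩
    · have := h₁.1 (n + 1)
      have := h₂.1 n
      exact Projective.of_iso (HomologicalComplex.homotopyCofiber.XIsoBiprod f n (n + 1) rfl).symm
        inferInstance
    · obtain ⟨a, ha⟩ := h₁.2.1
      obtain ⟨b, hb⟩ := h₂.2.1
      refine ⟨max a b, fun i hi => ?_⟩
      rw [HomotopyCategory.quotient_obj_as, IsZero.iff_id_eq_zero,
        ← CochainComplex.mappingCone.id_X f i (i + 1) rfl,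
        (ha (i + 1) (by lia)).eq_of_tgt
          ((CochainComplex.mappingCone.fst f).1.v i (i + 1) rfl) 0,
        (hb i (by lia)).eq_of_tgt ((CochainComplex.mappingCone.snd f).v i i (add_zero i)) 0]
      simp
    · rw [← bounded_Qh_iff]
      exact ObjectProperty.ext_of_isTriangulatedClosed₃ _ _
        (DerivedCategory.Qh.map_distinguished _ hE) ((bounded_Qh_iff C D.obj₁).2 h₁.2.2)
        ((bounded_Qh_iff C D.obj₂).2 h₂.2.2)
    · exact (comp_id _).trans (hf.symm.trans (id_comp _).symm)

open ZeroObject in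
instance : (projMinusBounded C).IsTriangulated where
  exists_zero := by
    have h (n : ℤ) : IsZero ((0 : CochainComplex C ℤ).X n) :=
      (HomologicalComplex.eval C (ComplexShape.up ℤ) n).map_isZero (isZero_zero _)
    refine ⟨(HomotopyCategory.quotient C _).obj 0,
      (HomotopyCategory.quotient C _).map_isZero (isZero_zero _), fun n => (h n).projective,
      ⟨0, fun i _ => h i⟩, ?_⟩
    refine Set.finite_empty.subset fun n hn => hn ?_
    exact Functor.map_isZero _ ((HomotopyCategory.quotient C _).map_isZero (isZero_zero _))
  toIsTriangulatedClosed₂ := .of_isTriangulatedClosed₃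

variable [HasDerivedCategory.{w} C]

instance : (projToDerived C).IsTriangulated :=
  inferInstanceAs ((ObjectProperty.lift _ ((projMinusBounded C).ι ⋙ DerivedCategory.Qh)
    (fun K => (bounded_Qh_iff C K.obj).2 K.property.2.2)).IsTriangulated)

instance [EnoughProjectives C] : (projToDerived C).inv.IsTriangulated := by
  let : (projToDerived C).asEquivalence.functor.CommShift ℤ :=
    inferInstanceAs ((projToDerived C).CommShift ℤ)
  have : (projToDerived C).asEquivalence.functor.IsTriangulated :=
    inferInstanceAs ((projToDerived C).IsTriangulated)
  let : (projToDerived C).asEquivalence.inverse.CommShift ℤ :=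
    (projToDerived C).asEquivalence.toAdjunction.rightAdjointCommShift ℤ
  have : (projToDerived C).asEquivalence.toAdjunction.CommShift ℤ :=
    (projToDerived C).asEquivalence.toAdjunction.commShift_of_leftAdjoint ℤ
  exact (projToDerived C).asEquivalence.toAdjunction.isTriangulated_rightAdjoint

variable {D : Type u'} [Category.{v'} D] [Abelian D] [HasDerivedCategory.{w'} D]

instance [EnoughProjectives C] (F : C ⥤ D) [F.Additive] : (leftDerived F).IsTriangulated :=
  inferInstanceAs (((projToDerived C).inv ⋙ (projMinusBounded C).ι ⋙
    F.mapHomotopyCategory (ComplexShape.up ℤ) ⋙ DerivedCategory.Qh).IsTriangulated)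

end

section

variable {k : Type t} [Field k] {A : Type u} [Category.{v} A] [Abelian A] [Linear k A]
  [HasExt.{w} A] (hA : IsExtFinite k A) {T : A} [IsNoetherianRing (End T)ᵐᵒᵖ]
  [HasDerivedCategory.{w₁} A] [HasDerivedCategory.{w₂} (FGModuleCat.{v} (End T)ᵐᵒᵖ)]

lemma derivedTensorBounded_isTriangulated
    (hb : ∀ X, DerivedCategory.TStructure.t.bounded ((derivedTensor hA T).obj X)) :
    (derivedTensorBounded hA T hb).IsTriangulated :=
  inferInstance

end

/-! ### A criterion for left Kan extensions. -/

section

variable {K : Type*} {D : Type*} {M : Type*} [Category K] [Category D] [Category M]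
  {L : K ⥤ D} {F : K ⥤ M} {R G : D ⥤ M} (α : F ⟶ L ⋙ R) (β : F ⟶ L ⋙ G) (Q : ObjectProperty K)

/-- The candidate α⁻¹ ≫ β must be natural for all morphisms between values of `L`. Each is a left
fraction, whose middle term can be moved into `Q`, where α is invertible; naturality of α and β then
suffices. -/
lemma inv_app_naturality
    (hα : ∀ Y, Q Y → IsIso (α.app Y))
    (hres : ∀ X, ∃ (Y : K) (s : X ⟶ Y), Q Y ∧ IsIso (L.map s))
    (hfrac : ∀ ⦃Y Y' : K⦄ (φ : L.obj Y ⟶ L.obj Y'), ∃ (Y'' : K) (g : Y ⟶ Y'') (s : Y' ⟶ Y''),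
      IsIso (L.map s) ∧ φ ≫ L.map s = L.map g)
    {Y Y' : K} [IsIso (α.app Y)] [IsIso (α.app Y')] (φ : L.obj Y ⟶ L.obj Y') :
    (inv (α.app Y) ≫ β.app Y) ≫ G.map φ = R.map φ ≫ inv (α.app Y') ≫ β.app Y' := by
  obtain ⟨Z₀, g₀, s₀, hs₀, fac₀⟩ := hfrac φ
  obtain ⟨Z, t, hZ, ht⟩ := hres Z₀
  have := hα Z hZ
  let g := g₀ ≫ t
  let s := s₀ ≫ t
  have fac : φ ≫ L.map s = L.map g := by simp [s, g, reassoc_of% fac₀]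
  have hs : IsIso (L.map s) := by
    rw [L.map_comp]
    infer_instance
  have nat (f : Y ⟶ Z) : inv (α.app Y) ≫ F.map f = R.map (L.map f) ≫ inv (α.app Z) := by
    rw [IsIso.inv_comp_eq, ← assoc, IsIso.eq_comp_inv]
    exact α.naturality f
  have nat' (f : Y' ⟶ Z) : inv (α.app Y') ≫ F.map f = R.map (L.map f) ≫ inv (α.app Z) := by
    rw [IsIso.inv_comp_eq, ← assoc, IsIso.eq_comp_inv]
    exact α.naturality f
  have h₁ : β.app Y ≫ G.map (L.map g) = F.map g ≫ β.app Z := (β.naturality g).symm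
  have h₂ : β.app Y' ≫ G.map (L.map s) = F.map s ≫ β.app Z := (β.naturality s).symm
  rw [← cancel_mono (G.map (L.map s))]
  simp only [assoc, ← G.map_comp, fac]
  rw [h₁, h₂, reassoc_of% nat, reassoc_of% nat', ← R.map_comp_assoc, fac]

lemma exists_desc_of_resolutions [L.EssSurj]
    (hα : ∀ Y, Q Y → IsIso (α.app Y))
    (hres : ∀ X, ∃ (Y : K) (s : X ⟶ Y), Q Y ∧ IsIso (L.map s))
    (hfrac : ∀ ⦃Y Y' : K⦄ (φ : L.obj Y ⟶ L.obj Y'), ∃ (Y'' : K) (g : Y ⟶ Y'') (s : Y' ⟶ Y''),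
      IsIso (L.map s) ∧ φ ≫ L.map s = L.map g) :
    ∃ γ : R ⟶ G, α ≫ Functor.whiskerLeft L γ = β := by
  have hobj (d : D) : ∃ Y, Q Y ∧ Nonempty (L.obj Y ≅ d) := by
    obtain ⟨Y, s, hY, hs⟩ := hres (L.objPreimage d)
    exact ⟨Y, hY, ⟨(asIso (L.map s)).symm ≪≫ L.objObjPreimageIso d⟩⟩
  choose Y hY e using hobj
  replace e (d : D) := (e d).some
  have (d : D) := hα _ (hY d)
  refine ⟨{ app := fun d => R.map (e d).inv ≫
        (inv (α.app (Y d)) ≫ β.app (Y d)) ≫ G.map (e d).hom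
            naturality := fun d d' φ => ?_ }, ?_⟩
  · have := inv_app_naturality α β Q hα hres hfrac ((e d).hom ≫ φ ≫ (e d').inv)
    rw [← cancel_mono (G.map (e d').inv), ← cancel_epi (R.map (e d).hom)]
    simpa [-NatTrans.naturality, -NatTrans.naturality_assoc, ← Functor.map_comp,
      ← Functor.map_comp_assoc] using this.symm
  · ext X
    -- α need not be invertible at `X`, so the comparison is made at a resolution `Z`.
    obtain ⟨Z, s, hZ, hs⟩ := hres X
    have := hα Z hZ
    have h := inv_app_naturality α β Q hα hres hfrac ((e (L.obj X)).hom ≫ L.map s)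
    have h₁ : β.app X ≫ G.map (L.map s) = F.map s ≫ β.app Z := (β.naturality s).symm
    have h₂ : α.app X ≫ R.map (L.map s) = F.map s ≫ α.app Z := (α.naturality s).symm
    rw [← cancel_mono (G.map (L.map s))]
    change (α.app X ≫ R.map _ ≫ (_ ≫ β.app _) ≫ G.map _) ≫ _ = β.app X ≫ _
    rw [h₁]
    simp only [assoc, ← G.map_comp] at h ⊢
    rw [h, R.map_comp, assoc, ← R.map_comp_assoc, Iso.inv_hom_id, R.map_id, id_comp,
      reassoc_of% h₂, IsIso.hom_inv_id_assoc]

lemma hom_ext_of_resolutions [L.EssSurj]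
    (hα : ∀ Y, Q Y → IsIso (α.app Y))
    (hres : ∀ X, ∃ (Y : K) (s : X ⟶ Y), Q Y ∧ IsIso (L.map s))
    {γ γ' : R ⟶ G} (h : ∀ X, α.app X ≫ γ.app (L.obj X) = α.app X ≫ γ'.app (L.obj X)) :
    γ = γ' := by
  ext d
  obtain ⟨Y, s, hY, hs⟩ := hres (L.objPreimage d)
  have := hα _ hY
  let e : L.obj Y ≅ d := (asIso (L.map s)).symm ≪≫ L.objObjPreimageIso d
  rw [← cancel_epi (R.map e.hom), γ.naturality, γ'.naturality]
  exact congrArg (· ≫ G.map e.hom) ((cancel_epi (α.app Y)).1 (h Y))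

/-- A criterion for `α : F ⟶ L ⋙ R` to exhibit `R` as the left Kan extension of `F` along a
functor `L` that behaves like a localization with a calculus of left fractions. -/
lemma isLeftKanExtension_of_resolutions [L.EssSurj]
    (hα : ∀ Y, Q Y → IsIso (α.app Y))
    (hres : ∀ X, ∃ (Y : K) (s : X ⟶ Y), Q Y ∧ IsIso (L.map s))
    (hfrac : ∀ ⦃Y Y' : K⦄ (φ : L.obj Y ⟶ L.obj Y'), ∃ (Y'' : K) (g : Y ⟶ Y'') (s : Y' ⟶ Y''),
      IsIso (L.map s) ∧ φ ≫ L.map s = L.map g) :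
    R.IsLeftKanExtension α := by
  have hdesc (E : L.LeftExtension F) :=
    exists_desc_of_resolutions (G := E.right) α E.hom Q hα hres hfrac
  choose γ hγ using hdesc
  refine ⟨⟨IsInitial.ofUniqueHom (fun E => StructuredArrow.homMk (γ E) (hγ E)) fun E m => ?_⟩⟩
  apply StructuredArrow.hom_ext
  refine hom_ext_of_resolutions (G := E.right) α Q hα hres fun X => ?_
  exact (NatTrans.congr_app (StructuredArrow.w m) X).trans
    (NatTrans.congr_app (hγ E) X).symm

end

/-! ### Bounded complexes and their left fractions. -/

section

variable {C : Type u} [Category.{v} C] [Abelian C]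

lemma boundedComplexes_iff (K : HomotopyCategory C (ComplexShape.up ℤ)) :
    boundedComplexes C K ↔ ∃ a b : ℤ, CochainComplex.IsStrictlyGE K.as a ∧ CochainComplex.IsStrictlyLE K.as b := by
  constructor
  · intro h
    obtain ⟨a, ha⟩ := h.bddBelow
    obtain ⟨b, hb⟩ := h.bddAbove
    refine ⟨a, b, (CochainComplex.isStrictlyGE_iff _ _).2 fun i hi => ?_,
      (CochainComplex.isStrictlyLE_iff _ _).2 fun i hi => ?_⟩
    · by_contra h'
      have := ha h'
      lia
    · by_contra h'
      have := hb h'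
      lia
  · rintro ⟨a, b, ha, hb⟩
    refine (Set.finite_Icc a b).subset fun n hn => ?_
    by_contra h
    rw [Set.mem_Icc, not_and_or] at h
    rcases h with h | h
    · exact hn (CochainComplex.isZero_of_isStrictlyGE K.as a n (by lia))
    · exact hn (CochainComplex.isZero_of_isStrictlyLE K.as b n (by lia))

variable [HasDerivedCategory.{w} C]

instance : (boundedToDerived C).EssSurj where
  mem_essImage X := by
    obtain ⟨⟨a, (ha : X.obj.IsGE a)⟩, ⟨b, (hb : X.obj.IsLE b)⟩⟩ := X.property
    obtain ⟨K, hK, hK', ⟨e⟩⟩ := X.obj.exists_iso_Q_obj_of_isGE_of_isLE a b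
    exact ⟨⟨(HomotopyCategory.quotient C _).obj K, (boundedComplexes_iff _).2 ⟨a, b, hK, hK'⟩⟩,
      ⟨ObjectProperty.isoMk _ ((DerivedCategory.quotientCompQhIso C).app K ≪≫ e.symm)⟩⟩

lemma isIso_boundedToDerived_map_iff {X Y : (boundedComplexes C).FullSubcategory} (f : X ⟶ Y) :
    IsIso ((boundedToDerived C).map f) ↔ IsIso (DerivedCategory.Qh.map f.hom) :=
  (isIso_iff_of_reflects_iso ((boundedToDerived C).map f)
    DerivedCategory.TStructure.t.bounded.ι).symm

lemma exists_boundedToDerived_leftFraction {Y Y' : (boundedComplexes C).FullSubcategory}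
    (φ : (boundedToDerived C).obj Y ⟶ (boundedToDerived C).obj Y') :
    ∃ (Y'' : (boundedComplexes C).FullSubcategory) (g : Y ⟶ Y'') (s : Y' ⟶ Y''),
      IsIso ((boundedToDerived C).map s) ∧
        φ ≫ (boundedToDerived C).map s = (boundedToDerived C).map g := by
  obtain ⟨a₁, b₁, -, h₁⟩ := (boundedComplexes_iff _).1 Y.property
  obtain ⟨a₂, b₂, h₂, h₃⟩ := (boundedComplexes_iff _).1 Y'.property
  -- A common upper bound for both complexes and a lower bound for the target alone let the middle
  -- term of the fraction be chosen bounded.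
  have : CochainComplex.IsStrictlyLE Y.obj.as (max b₁ b₂) := CochainComplex.isStrictlyLE_of_le Y.obj.as _ _ (le_max_left _ _)
  have : CochainComplex.IsStrictlyLE Y'.obj.as (max b₁ b₂) := CochainComplex.isStrictlyLE_of_le Y'.obj.as _ _ (le_max_right _ _)
  obtain ⟨Z, hZ, hZ', g, s, hs, fac⟩ :=
    DerivedCategory.left_fac_of_isStrictlyLE_of_isStrictlyGE (X := Y.obj.as) (Y := Y'.obj.as)
      a₂ (max b₁ b₂) φ.hom
  refine ⟨⟨(HomotopyCategory.quotient C _).obj Z, (boundedComplexes_iff _).2 ⟨_, _, hZ, hZ'⟩⟩,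
    ObjectProperty.homMk ((HomotopyCategory.quotient C _).map g),
    ObjectProperty.homMk ((HomotopyCategory.quotient C _).map s),
    (isIso_boundedToDerived_map_iff _).2 hs, ?_⟩
  apply ObjectProperty.hom_ext
  exact (congrArg (· ≫ DerivedCategory.Q.map s) fac).trans
    ((assoc _ _ _).trans ((congrArg (DerivedCategory.Q.map g ≫ ·) (IsIso.inv_hom_id _)).trans
      (comp_id _)))

end

/-! ### The right adjoint as right derived functor of Hom(T, -). -/

section

variable {k : Type t} [Field k] {A : Type u} [Category.{v} A] [Abelian A] [Linear k A]
  [HasExt.{w} A] {T : A} [HasDerivedCategory.{w₁} A]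

lemma exists_isIso_boundedToDerived_map_extAcyclic (hA : IsExtFinite k A)
    [HasProjectiveDimensionLE T 1] (hT : IsTilting T) (X : (boundedComplexes A).FullSubcategory) :
    ∃ (Y : (boundedComplexes A).FullSubcategory) (s : X ⟶ Y),
      (extAcyclicComplexes T).inverseImage (boundedComplexes A).ι Y ∧
        IsIso ((boundedToDerived A).map s) := by
  obtain ⟨L, s, hs, hL, hL₀⟩ := exists_isIso_Qh_map_extAcyclic hA hT X.obj
  have hLb : boundedComplexes A L := by
    have h := X.property
    refine (h.union (h.image (fun n => n + 1))).subset fun n hn => ?_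
    by_contra hn'
    rw [Set.mem_union, not_or] at hn'
    refine hn (hL₀ n ?_ ?_)
    · by_contra h'
      exact hn'.2 ⟨n - 1, h', by simp⟩
    · simpa using hn'.1
  exact ⟨⟨L, hLb⟩, ObjectProperty.homMk s, hL, (isIso_boundedToDerived_map_iff _).2 hs⟩

variable (hA : IsExtFinite k A) [IsNoetherianRing (End T)ᵐᵒᵖ]
  [HasDerivedCategory.{w₂} (FGModuleCat.{v} (End T)ᵐᵒᵖ)]

/-- The morphism `P ⊗ T ⟶ X` in the derived category that corresponds to `P ⟶ Hom(T, X)`, for a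
right bounded complex of projectives `P`. -/
def projMinus.tensorDesc
    {P : HomotopyCategory (FGModuleCat.{v} (End T)ᵐᵒᵖ) (ComplexShape.up ℤ)} (hP : projMinus P)
    {X : HomotopyCategory A (ComplexShape.up ℤ)}
    (φ : DerivedCategory.Qh.obj P ⟶ DerivedCategory.Qh.obj ((homComplex hA T).obj X)) :
    DerivedCategory.Qh.obj ((tensorComplex hA T).obj P) ⟶ DerivedCategory.Qh.obj X :=
  DerivedCategory.Qh.map (((complexAdjunction hA T).homEquiv P X).symm
    ((hP.Qh_map_bijective _).surjective φ).choose)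

lemma projMinus.tensorDesc_Qh_map
    {P : HomotopyCategory (FGModuleCat.{v} (End T)ᵐᵒᵖ) (ComplexShape.up ℤ)} (hP : projMinus P)
    {X : HomotopyCategory A (ComplexShape.up ℤ)} (f : P ⟶ (homComplex hA T).obj X) :
    hP.tensorDesc hA (DerivedCategory.Qh.map f) =
      DerivedCategory.Qh.map (((complexAdjunction hA T).homEquiv P X).symm f) :=
  congrArg (fun g => DerivedCategory.Qh.map (((complexAdjunction hA T).homEquiv P X).symm g))
    ((hP.Qh_map_bijective _).injective ((hP.Qh_map_bijective _).surjective _).choose_spec)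

lemma projMinus.map_comp_tensorDesc
    {P P' : HomotopyCategory (FGModuleCat.{v} (End T)ᵐᵒᵖ) (ComplexShape.up ℤ)} (hP : projMinus P)
    (hP' : projMinus P') {X : HomotopyCategory A (ComplexShape.up ℤ)} (f : P ⟶ P')
    (φ : DerivedCategory.Qh.obj P' ⟶ DerivedCategory.Qh.obj ((homComplex hA T).obj X)) :
    DerivedCategory.Qh.map ((tensorComplex hA T).map f) ≫ hP'.tensorDesc hA φ =
      hP.tensorDesc hA (DerivedCategory.Qh.map f ≫ φ) := by
  obtain ⟨ψ, rfl⟩ := (hP'.Qh_map_bijective _).surjective φ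
  rw [← Functor.map_comp, tensorDesc_Qh_map, tensorDesc_Qh_map, ← Functor.map_comp,
    Adjunction.homEquiv_naturality_left_symm]

lemma projMinus.tensorDesc_comp_map
    {P : HomotopyCategory (FGModuleCat.{v} (End T)ᵐᵒᵖ) (ComplexShape.up ℤ)} (hP : projMinus P)
    {X X' : HomotopyCategory A (ComplexShape.up ℤ)}
    (φ : DerivedCategory.Qh.obj P ⟶ DerivedCategory.Qh.obj ((homComplex hA T).obj X))
    (f : X ⟶ X') :
    hP.tensorDesc hA φ ≫ DerivedCategory.Qh.map f =
      hP.tensorDesc hA (φ ≫ DerivedCategory.Qh.map ((homComplex hA T).map f)) := by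
  obtain ⟨ψ, rfl⟩ := (hP.Qh_map_bijective _).surjective φ
  rw [← Functor.map_comp, tensorDesc_Qh_map, tensorDesc_Qh_map, ← Functor.map_comp,
    Adjunction.homEquiv_naturality_right_symm]

lemma IsTilting.isIso_tensorDesc (hT : IsTilting T)
    {P : HomotopyCategory (FGModuleCat.{v} (End T)ᵐᵒᵖ) (ComplexShape.up ℤ)} (hP : projMinus P)
    {X : HomotopyCategory A (ComplexShape.up ℤ)} (hX : extAcyclicComplexes T X)
    (φ : DerivedCategory.Qh.obj P ⟶ DerivedCategory.Qh.obj ((homComplex hA T).obj X)) (hφ : IsIso φ) :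
    IsIso (hP.tensorDesc hA φ) := by
  obtain ⟨ψ, rfl⟩ := (hP.Qh_map_bijective _).surjective φ
  rw [projMinus.tensorDesc_Qh_map, ← hT.isIso_Qh_map_homEquiv_iff hA hP hX,
    Equiv.apply_symm_apply]
  exact hφ

variable (hb : ∀ X, DerivedCategory.TStructure.t.bounded ((derivedTensor hA T).obj X))

/-- The canonical morphism from `Hom(T, X) ⊗ᴸ T` to `X`, for a bounded complex `X`. -/
def tensorHomDesc :
    mapBounded (homFunctor hA T) ⋙ derivedTensorBounded hA T hb ⟶ boundedToDerived A where
  app X := ObjectProperty.homMk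
    -- The source is a projective resolution of Hom(T, X), and the map to Hom(T, X) is the counit of
    -- the equivalence `projToDerived`.
    (projMinus.tensorDesc hA ((projToDerived _).inv.obj
        ((mapBounded (homFunctor hA T)).obj X)).property.projMinus
      ((projToDerived _).asEquivalence.counit.app ((mapBounded (homFunctor hA T)).obj X)).hom)
  naturality X Y f := by
    apply ObjectProperty.hom_ext
    have h := congrArg (fun f => f.hom)
      ((projToDerived _).asEquivalence.counit.naturality ((mapBounded (homFunctor hA T)).map f))
    have hP (Z : (boundedComplexes A).FullSubcategory) := ((projToDerived _).inv.obj
      ((mapBounded (homFunctor hA T)).obj Z)).property.projMinus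
    refine ((hP X).map_comp_tensorDesc hA (hP Y) _ _).trans
      (Eq.trans ?_ ((hP X).tensorDesc_comp_map hA _ _).symm)
    exact congrArg _ h

lemma IsTilting.isIso_tensorHomDesc_app (hT : IsTilting T)
    (X : (boundedComplexes A).FullSubcategory) (hX : extAcyclicComplexes T X.obj) :
    IsIso ((tensorHomDesc hA hb).app X) := by
  rw [← isIso_iff_of_reflects_iso _ DerivedCategory.TStructure.t.bounded.ι]
  have : IsIso ((projToDerived _).asEquivalence.counit.app
    ((mapBounded (homFunctor hA T)).obj X)).hom :=
    inferInstanceAs (IsIso (DerivedCategory.TStructure.t.bounded.ι.map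
      ((projToDerived _).asEquivalence.counitIso.hom.app ((mapBounded (homFunctor hA T)).obj X))))
  exact hT.isIso_tensorDesc hA ((projToDerived _).inv.obj
    ((mapBounded (homFunctor hA T)).obj X)).property.projMinus hX _ this

variable {hb} in
/-- The adjunct of `tensorHomDesc`. -/
def homUnit {R : DerivedCategory.Bounded A ⥤ DerivedCategory.Bounded (FGModuleCat.{v} (End T)ᵐᵒᵖ)}
    (adj : derivedTensorBounded hA T hb ⊣ R) :
    mapBounded (homFunctor hA T) ⟶ boundedToDerived A ⋙ R where
  app X := adj.homEquiv _ _ ((tensorHomDesc hA hb).app X)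
  naturality X Y f := by
    refine (adj.homEquiv_naturality_left _ _).symm.trans
      (Eq.trans ?_ (adj.homEquiv_naturality_right _ _))
    exact congrArg _ ((tensorHomDesc hA hb).naturality f)

/-- On acyclic terms `homUnit` is the unit followed by `R` of the isomorphism `tensorHomDesc`, so it
is invertible there and the Kan extension criterion applies. -/
lemma IsTilting.isRightDerived (hT : IsTilting T)
    {R : DerivedCategory.Bounded A ⥤ DerivedCategory.Bounded (FGModuleCat.{v} (End T)ᵐᵒᵖ)}
    (adj : derivedTensorBounded hA T hb ⊣ R) (hadj : IsIso adj.unit) :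
    IsRightDerived (homFunctor hA T) R := by
  have := hT.hasProjectiveDimensionLE_one
  refine ⟨homUnit hA adj, isLeftKanExtension_of_resolutions _
    ((extAcyclicComplexes T).inverseImage (boundedComplexes A).ι) (fun Y hY => ?_)
    (exists_isIso_boundedToDerived_map_extAcyclic hA hT)
    (fun _ _ => exists_boundedToDerived_leftFraction)⟩
  have := hT.isIso_tensorHomDesc_app hA hb Y hY
  change IsIso (adj.homEquiv _ _ _)
  rw [Adjunction.homEquiv_unit]
  infer_instance

end

end Tilting

end

theorem mainTheorem8 {k : Type t} [Field k] {A : Type u} [Category.{v} A] [Abelian A] [Linear k A]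
    [HasExt.{w} A] (hA : Tilting.IsExtFinite k A) (T : A) (hT : Tilting.IsTilting T)
    [HasDerivedCategory.{w₁} A] :
    haveI : IsNoetherianRing (End T)ᵐᵒᵖ := hA.isNoetherianRing_end T
    ∀ [HasDerivedCategory.{w₂} (FGModuleCat.{v} (End T)ᵐᵒᵖ)],
      ∃ hb : ∀ X, DerivedCategory.TStructure.t.bounded ((Tilting.derivedTensor hA T).obj X),
        (Tilting.derivedTensorBounded hA T hb).IsTriangulated ∧
        (Tilting.derivedTensorBounded hA T hb).IsEquivalence ∧
        ∃ R : DerivedCategory.Bounded A ⥤ DerivedCategory.Bounded (FGModuleCat.{v} (End T)ᵐᵒᵖ),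
          Tilting.IsRightDerived (Tilting.homFunctor hA T) R ∧
          ∃ adj : Tilting.derivedTensorBounded hA T hb ⊣ R,
            IsIso adj.unit ∧ IsIso adj.counit := by
  have : IsNoetherianRing (End T)ᵐᵒᵖ := hA.isNoetherianRing_end T
  intro _
  have := hT.derivedTensor_isEquivalence hA
  let E := (Tilting.derivedTensorBounded hA T (hT.bounded_derivedTensor hA)).asEquivalence
  have h₁ : IsIso E.toAdjunction.unit := inferInstanceAs (IsIso E.unitIso.hom)
  have h₂ : IsIso E.toAdjunction.counit := inferInstanceAs (IsIso E.counitIso.hom)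
  exact ⟨hT.bounded_derivedTensor hA, Tilting.derivedTensorBounded_isTriangulated hA _, this,
    _, hT.isRightDerived hA _ E.toAdjunction h₁, E.toAdjunction, h₁, h₂⟩
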